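/- For a graph $G$ and a graph $J$, let $N(G,J)$ be the number of copies of $J$ in $G$, that is, of (unlabeled, not necessarily induced) subgraphs of $G$ isomorphic to $J$. For an integer $n\ge 0$ and $p\in[0,1]$ let $G_{n,p}$ be the random graph with vertex set $\{1,\dots,n\}$ that contains each edge of $K_n$ with probability $p$, independently, and put $\mathbb{E}_pX_J=\mathbb{E}\,N(G_{n,p},J)$. For $q\in[0,1]$, a finite graph $H$ is called $q$-sparse if $\mathbb{E}_qX_I\ge 1$ for every subgraph $I\subseteq H$. Write $\log=\log_2$ (with the convention $\log 0=0$). **Theorem 1.8.** There is an absolute constant $K>0$ such that the following holds for every integer $n\ge 0$, all $p,q\in[0,1]$ and every finite graph $H$. If $H$ is $q$-sparse and $p=Kq\log^2 n$, then $$N(H,F)<\mathbb{E}_pX_F\qquad\text{for every subgraph } F\subseteq H \text{ with at least one edge},\tag{$*$}$$ and $N(H,F)\le\mathbb{E}_pX_F$ for every subgraph $F\subseteq H$ without edges. Furthermore, there is an absolute constant $\alpha>0$ such that, for every integer $n\ge1$, all $p,q\in[0,1]$ and every finite graph $H$, the same conclusion (that is, $(*)$ together with the non-strict inequality for edgeless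 $F\subseteq H$) holds if $H$ is $q$-sparse and $q=\alpha p<1/(3n)$. -/

import Mathlib

open MeasureTheory

/-- `expectedCopies n p J` is the expectation of the number of (unlabelled) copies of `J` in the
binomial random graph on `n` labelled vertices with edge probability `p`. -/
noncomputable def expectedCopies (n : ℕ) (p : unitInterval) {W : Type*} (J : SimpleGraph W) : ℝ :=
  ∫ G : SimpleGraph (Fin n), (G.copyCount J : ℝ) ∂(SimpleGraph.binomialRandom (Fin n) p)

/-- `J` is `q`-sparse (relative to `n`): every subgraph of `J`, induced or not, has on average at
least one copy in the binomial random graph with parameters `n` and `q`. -/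
def IsSparse (n : ℕ) (q : unitInterval) {V : Type*} (J : SimpleGraph V) : Prop :=
  ∀ I : J.Subgraph, 1 ≤ expectedCopies n q I.coe

/-! Sparsity enters through automorphisms alone. Since `E X_J * |Aut J| = (n)_v p^e`, a `q`-sparse
`H` satisfies `|Aut J| ≤ n^v q^e` for each `J` that it contains (`IsSparse.card_aut_le`). If `H`
contains `m` copies of a graph that share a core and are otherwise disjoint, their union has at
least `m!` automorphisms, so `m` is bounded (`IsSparse.petal_bound`). Conversely, it suffices to
show that `H` has at most `(n)_v p^e` labelled copies of `F`, strictly fewer if `F` has edges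
(`copyCount_bounds_of_extensions`).

For the first statement, with `L = log n`, an embedding of `F[S]` is built in stages, and `n^|S|
(2q)^e(S)` serves as the weight of a stage. Vertices of degree above `L` are placed first and
arbitrarily, at cost `4^e(F)`. Next comes a superset `T` of them of minimum weight. No step towards
`T` is expected to gain copies, and every extension is confined to a subset `X` of `V(H)` that is
closed under weight-reducing additions and spans few edges: at most `L` for each vertex of the core.
Choosing the images of the edges inside `X`, then tracing vertices along edges of `F`, costs `O(L)`
per edge and `L` per vertex (`card_extensions_le_of_relWeight_le_one`). From `T` to `S` one proceeds
by blocks which gain weight as a whole, while no proper part gains once the rest is placed. A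
maximal packing of extensions fixes one vertex of a block, and the rest of the block is counted as
before (`card_extensions_le_of_block`). In total each edge costs `O(q L^2)`, as stated in
`card_extensions_self_le`.

In the range `q < 1/(3n)` every component of `H` is a tree. The petal bound with empty core limits
the components of each isomorphism type, and summing over the trees that contain a connected `T`
gives a convergent geometric series (`labelledCopyCount_connected_le`), so no logarithm is lost. -/

set_option linter.unusedSectionVars false

/-! ### Labelled and unlabelled copies. -/

section CopyCounts

lemma finite_aut {W : Type*} [Finite W] (J : SimpleGraph W) : Finite (J ≃g J) :=
  Finite.of_injective (fun f => f.toEquiv) (fun f g h => by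
    ext a; exact DFunLike.congr_fun h a)

lemma labelledCopyCount_eq_natCard {V W : Type*} [Fintype V] [Fintype W]
    (G : SimpleGraph V) (J : SimpleGraph W) :
    G.labelledCopyCount J =
      Nat.card {f : W → V // Function.Injective f ∧ ∀ u v, J.Adj u v → G.Adj (f u) (f v)} := by
  classical
  rw [SimpleGraph.labelledCopyCount, ← Nat.card_eq_fintype_card]
  exact Nat.card_congr
    { toFun := fun f => ⟨f, f.injective, fun u v h => f.toHom.map_adj h⟩
      invFun := fun f => ⟨⟨f.1, fun {a b} h => f.2.2 a b h⟩, f.2.1⟩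
      left_inv := fun f => rfl
      right_inv := fun f => rfl }

open scoped Classical in
/-- Labelled copies are unlabelled copies together with an automorphism. -/
lemma labelledCopyCount_eq_copyCount_mul {V W : Type*} [Fintype V] [Fintype W]
    (G : SimpleGraph V) (J : SimpleGraph W) :
    G.labelledCopyCount J = G.copyCount J * Nat.card (J ≃g J) := by
  have := finite_aut J
  have := Fintype.ofFinite (J ≃g J)
  rw [SimpleGraph.copyCount_eq_card_image_copyToSubgraph, SimpleGraph.labelledCopyCount]
  rw [← Finset.card_univ, Finset.card_eq_sum_card_image (SimpleGraph.Copy.toSubgraph)]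
  rw [Finset.sum_const_nat (m := Nat.card (J ≃g J))]
  intro G' hG'
  obtain ⟨f₀, -, rfl⟩ := Finset.mem_image.1 hG'
  have key : ∀ f : J.Copy G, f.toSubgraph = f₀.toSubgraph →
      ∃ e : J ≃g f₀.toSubgraph.coe, ∀ a, (e a : V) = f a := by
    intro f hf
    rw [← hf]
    exact ⟨f.isoToSubgraph, fun a => rfl⟩
  symm
  rw [Nat.card_eq_fintype_card, ← Finset.card_univ]
  refine Finset.card_bij (fun σ _ => f₀.comp (σ : J ≃g J).toCopy) ?_ ?_ ?_
  · intro σ _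
    rw [Finset.mem_filter]
    refine ⟨Finset.mem_univ _, ?_⟩
    ext a b
    · simp only [SimpleGraph.Subgraph.map_verts, SimpleGraph.Subgraph.verts_top, Set.image_univ,
        Set.mem_range]
      exact ⟨fun ⟨x, hx⟩ => ⟨σ x, hx⟩, fun ⟨x, hx⟩ => ⟨σ.symm x, by
        rw [← hx]; exact congrArg f₀ (σ.apply_symm_apply x)⟩⟩
    · simp only [SimpleGraph.Subgraph.map_adj, SimpleGraph.Subgraph.top_adj, Relation.Map]
      constructor
      · rintro ⟨x, y, h, rfl, rfl⟩
        exact ⟨σ x, σ y, σ.map_rel_iff.2 h, rfl, rfl⟩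
      · rintro ⟨x, y, h, rfl, rfl⟩
        exact ⟨σ.symm x, σ.symm y, σ.symm.map_rel_iff.2 h,
          congrArg f₀ (σ.apply_symm_apply x), congrArg f₀ (σ.apply_symm_apply y)⟩
  · intro σ _ τ _ h
    ext a
    exact f₀.injective (DFunLike.congr_fun h a)
  · intro f hf
    obtain ⟨e, he⟩ := key f (Finset.mem_filter.1 hf).2
    obtain ⟨e₀, he₀⟩ := key f₀ rfl
    refine ⟨e.trans e₀.symm, Finset.mem_univ _, ?_⟩
    ext a
    change f₀ (e₀.symm (e a)) = f a
    rw [← he, ← he₀]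
    exact congrArg Subtype.val (e₀.apply_symm_apply (e a))

end CopyCounts

/-! ### Expected copy counts, and sparsity as a bound on automorphism groups. -/

section Expectation

lemma measurableSet_superset {V : Type*} [Countable V] (D : Finset (Sym2 V)) :
    MeasurableSet {G : SimpleGraph V | (D : Set (Sym2 V)) ⊆ G.edgeSet} := by
  have : {G : SimpleGraph V | (D : Set (Sym2 V)) ⊆ G.edgeSet} =
      ⋂ e ∈ D, SimpleGraph.edgeSet ⁻¹' {s | e ∈ s} := by
    ext; simp [Set.subset_def]
  rw [this]
  refine Finset.measurableSet_biInter D fun e _ => SimpleGraph.measurable_edgeSet ?_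
  exact measurableSet_setOfPred.2 (measurable_set_mem e)

lemma binomialRandom_superset {V : Type*} [Countable V] (p : unitInterval)
    (D : Finset (Sym2 V)) (hD : ∀ e ∈ D, ¬ e.IsDiag) :
    SimpleGraph.binomialRandom V p {G | (D : Set (Sym2 V)) ⊆ G.edgeSet} =
      (unitInterval.toNNReal p : ENNReal) ^ D.card := by
  rw [SimpleGraph.binomialRandom_eq_map, Measure.map_apply (by fun_prop)]
  · have : SimpleGraph.fromEdgeSet ⁻¹' {G : SimpleGraph V | (D : Set (Sym2 V)) ⊆ G.edgeSet} =
        {s : Set (Sym2 V) | (D : Set (Sym2 V)) ⊆ s} := by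
      ext s
      simp only [Set.mem_preimage, Set.mem_ofPred_eq, SimpleGraph.edgeSet_fromEdgeSet]
      constructor
      · exact fun h e he => (h he).1
      · exact fun h e he => ⟨h he, hD e he⟩
    rw [this, ProbabilityTheory.setBernoulli_apply']
    have h2 : ((fun p ↦ {i | p i}) ⁻¹' {s : Set (Sym2 V) | (D : Set (Sym2 V)) ⊆ s}) =
        Set.pi (D : Set (Sym2 V)) (fun _ => {True}) := by
      ext f
      simp [Set.subset_def, Set.mem_pi]
    rw [h2, Measure.infinitePi_pi]
    · rw [Finset.prod_congr rfl (g := fun _ => (unitInterval.toNNReal p : ENNReal))]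
      · simp
      · intro e he
        have : e ∈ (Sym2.diagSetᶜ : Set (Sym2 V)) := by
          simpa using hD e he
        simp [this]
    · intro i _
      measurability
  · exact measurableSet_superset D

open scoped Classical in
lemma integral_labelledCopyCount (n : ℕ) (p : unitInterval) {W : Type*} [Fintype W]
    (J : SimpleGraph W) :
    ∫ G : SimpleGraph (Fin n), (G.labelledCopyCount J : ℝ)
      ∂(SimpleGraph.binomialRandom (Fin n) p) =
      (n.descFactorial (Fintype.card W) : ℝ) * (p : ℝ) ^ Nat.card J.edgeSet := by
  let D : (W ↪ Fin n) → Finset (Sym2 (Fin n)) := fun f => J.edgeFinset.map f.sym2Map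
  have hcount : ∀ G : SimpleGraph (Fin n), (G.labelledCopyCount J : ℝ) =
      ∑ f : W ↪ Fin n, Set.indicator {G : SimpleGraph (Fin n) | (D f : Set (Sym2 (Fin n))) ⊆
        G.edgeSet} (fun _ => (1 : ℝ)) G := by
    intro G
    have : ∀ f : W ↪ Fin n, G ∈ {G : SimpleGraph (Fin n) | (D f : Set (Sym2 (Fin n))) ⊆
        G.edgeSet} ↔ ∀ u v, J.Adj u v → G.Adj (f u) (f v) := by
      intro f
      simp only [D, Finset.coe_map, Set.mem_ofPred_eq, Set.image_subset_iff,
        SimpleGraph.coe_edgeFinset]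
      constructor
      · intro h u v huv
        exact h ((SimpleGraph.mem_edgeSet J).2 huv)
      · rintro h ⟨u, v⟩ huv
        exact h u v huv
    simp only [Set.indicator_apply, this]
    rw [Finset.sum_boole, labelledCopyCount_eq_natCard, ← Fintype.card_subtype,
      ← Nat.card_eq_fintype_card]
    congr 1
    exact Nat.card_congr
      { toFun := fun f => ⟨⟨f.1, f.2.1⟩, f.2.2⟩
        invFun := fun f => ⟨f.1, f.1.injective, f.2⟩
        left_inv := fun f => rfl
        right_inv := fun f => rfl }
  simp only [hcount]
  have hcard : ∀ f, (D f).card = Nat.card J.edgeSet := by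
    intro f
    rw [Finset.card_map, Nat.card_eq_fintype_card, SimpleGraph.edgeFinset_card]
  have hdiag : ∀ f, ∀ e ∈ D f, ¬ e.IsDiag := by
    intro f e he
    simp only [D, Finset.mem_map, SimpleGraph.mem_edgeFinset] at he
    obtain ⟨e', he', rfl⟩ := he
    induction e' with | _ u v =>
    simpa using J.ne_of_adj he'
  rw [integral_finsetSum]
  · simp only [integral_indicator_const _ (measurableSet_superset _), measureReal_def,
      binomialRandom_superset p _ (hdiag _), hcard]
    simp [Fintype.card_embedding_eq]
  · intro f _
    exact (integrable_const (1 : ℝ)).indicator (measurableSet_superset _)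

/-- The expected number of copies of `J`, times the number of automorphisms of `J`. -/
lemma expectedCopies_mul_card_aut (n : ℕ) (p : unitInterval) {W : Type*} [Fintype W]
    (J : SimpleGraph W) :
    expectedCopies n p J * Nat.card (J ≃g J) =
      (n.descFactorial (Fintype.card W) : ℝ) * (p : ℝ) ^ Nat.card J.edgeSet := by
  rw [← integral_labelledCopyCount, expectedCopies, ← integral_mul_const]
  congr 1
  ext G
  rw [labelledCopyCount_eq_copyCount_mul]
  push_cast
  rfl

lemma expectedCopies_congr (n : ℕ) (p : unitInterval) {W W' : Type*}
    {J : SimpleGraph W} {J' : SimpleGraph W'} (e : J ≃g J') :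
    expectedCopies n p J = expectedCopies n p J' := by
  unfold expectedCopies
  congr 1
  ext G
  congr 1
  unfold SimpleGraph.copyCount
  congr 1
  ext G'
  simp only [Finset.mem_filter, Finset.mem_univ, true_and]
  exact ⟨fun ⟨f⟩ => ⟨e.symm.trans f⟩, fun ⟨f⟩ => ⟨e.trans f⟩⟩

lemma card_aut_pos {W : Type*} [Finite W] (J : SimpleGraph W) : 0 < Nat.card (J ≃g J) := by
  have : Nonempty (J ≃g J) := ⟨SimpleGraph.Iso.refl⟩
  have := finite_aut J
  exact Nat.card_pos

/-- The automorphisms of any graph contained in a `q`-sparse graph are few. -/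
lemma IsSparse.card_aut_le_descFactorial {n : ℕ} {q : unitInterval} {V : Type*} {H : SimpleGraph V}
    (h : IsSparse n q H) {W : Type*} [Fintype W] {J : SimpleGraph W} (f : J.Copy H) :
    (Nat.card (J ≃g J) : ℝ) ≤
      (n.descFactorial (Fintype.card W) : ℝ) * (q : ℝ) ^ Nat.card J.edgeSet := by
  rw [← expectedCopies_mul_card_aut, expectedCopies_congr n q f.isoToSubgraph]
  exact le_mul_of_one_le_left (Nat.cast_nonneg _) (h _)

lemma IsSparse.card_aut_le {n : ℕ} {q : unitInterval} {V : Type*} {H : SimpleGraph V}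
    (h : IsSparse n q H) {W : Type*} [Fintype W] {J : SimpleGraph W} (f : J.Copy H) :
    (Nat.card (J ≃g J) : ℝ) ≤ (n : ℝ) ^ Fintype.card W * (q : ℝ) ^ Nat.card J.edgeSet := by
  refine (h.card_aut_le_descFactorial f).trans ?_
  have := q.2.1
  gcongr
  exact_mod_cast Nat.descFactorial_le_pow _ _

/-- The falling factorial vanishes for a graph with more than `n` vertices, while the identity is an
automorphism of `H`. -/
lemma IsSparse.card_le {n : ℕ} {q : unitInterval} {V : Type*} [Fintype V] {H : SimpleGraph V}
    (h : IsSparse n q H) : Fintype.card V ≤ n := by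
  by_contra hlt
  have h1 := h.card_aut_le_descFactorial (SimpleGraph.Copy.id H)
  rw [Nat.descFactorial_eq_zero_iff_lt.2 (not_le.1 hlt)] at h1
  have := card_aut_pos H
  simp at h1
  omega

/-- Comparison of labelled counts suffices for comparison of unlabelled counts. -/
lemma copyCount_le_expectedCopies {n : ℕ} {p : unitInterval} {V W : Type*} [Fintype V] [Fintype W]
    {H : SimpleGraph V} {J : SimpleGraph W}
    (h : (H.labelledCopyCount J : ℝ) ≤
      (n.descFactorial (Fintype.card W) : ℝ) * (p : ℝ) ^ Nat.card J.edgeSet) :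
    (H.copyCount J : ℝ) ≤ expectedCopies n p J := by
  rw [← expectedCopies_mul_card_aut, labelledCopyCount_eq_copyCount_mul] at h
  push_cast at h
  exact le_of_mul_le_mul_right h (by exact_mod_cast card_aut_pos J)

lemma copyCount_lt_expectedCopies {n : ℕ} {p : unitInterval} {V W : Type*} [Fintype V] [Fintype W]
    {H : SimpleGraph V} {J : SimpleGraph W}
    (h : (H.labelledCopyCount J : ℝ) <
      (n.descFactorial (Fintype.card W) : ℝ) * (p : ℝ) ^ Nat.card J.edgeSet) :
    (H.copyCount J : ℝ) < expectedCopies n p J := by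
  rw [← expectedCopies_mul_card_aut, labelledCopyCount_eq_copyCount_mul] at h
  push_cast at h
  exact lt_of_mul_lt_mul_right h (by positivity)

end Expectation

/-! ### Copies glued along a common core. -/

section Petals

variable {α β ι : Type*}

/-- The graph obtained from disjointly indexed copies of `T` by gluing them along `β`. -/
def petalGraph (T : SimpleGraph (β ⊕ α)) (ι : Type*) : SimpleGraph (β ⊕ ι × α) where
  Adj x y := T.Adj (Sum.map id Prod.snd x) (Sum.map id Prod.snd y) ∧
    ∀ i j a b, x = Sum.inr (i, a) → y = Sum.inr (j, b) → i = j
  symm := ⟨fun _ _ h => ⟨h.1.symm, fun i j a b hx hy => (h.2 j i b a hy hx).symm⟩⟩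
  loopless := ⟨fun _ h => T.loopless.irrefl _ h.1⟩

lemma petalGraph_adj_inr_inr (T : SimpleGraph (β ⊕ α)) (i j : ι) (x y : α) :
    (petalGraph T ι).Adj (Sum.inr (i, x)) (Sum.inr (j, y)) ↔
      i = j ∧ T.Adj (Sum.inr x) (Sum.inr y) := by
  constructor
  · exact fun h => ⟨h.2 i j x y rfl rfl, h.1⟩
  · rintro ⟨rfl, h⟩
    refine ⟨h, ?_⟩
    rintro _ _ _ _ h1 h2
    simp only [Sum.inr.injEq, Prod.mk.injEq] at h1 h2
    rw [← h1.1, ← h2.1]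

/-- The automorphisms of `T` that fix `β` pointwise. -/
abbrev RelAut (T : SimpleGraph (β ⊕ α)) : Type _ :=
  {g : Equiv.Perm α // ∀ x y, T.Adj (Sum.map id g x) (Sum.map id g y) ↔ T.Adj x y}

/-- Permuting the petals and applying an automorphism in each of them. -/
def petalAut (T : SimpleGraph (β ⊕ α)) (σ : Equiv.Perm ι) (g : ι → RelAut T) :
    petalGraph T ι ≃g petalGraph T ι where
  toEquiv := Equiv.sumCongr (Equiv.refl β) (Equiv.prodShear σ fun i => (g i).1)
  map_rel_iff' := by
    rintro (x | ⟨i, x⟩) (y | ⟨j, y⟩)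
    · simp [petalGraph]
    · simpa [petalGraph] using (g j).2 (Sum.inl x) (Sum.inr y)
    · simpa [petalGraph] using (g i).2 (Sum.inr x) (Sum.inl y)
    · simp only [Equiv.sumCongr_apply, Sum.map_inr, Equiv.prodShear_apply,
        petalGraph_adj_inr_inr, σ.injective.eq_iff]
      refine and_congr_right ?_
      rintro rfl
      exact (g i).2 (Sum.inr x) (Sum.inr y)

lemma petalAut_injective [Nonempty α] (T : SimpleGraph (β ⊕ α)) :
    Function.Injective (fun x : Equiv.Perm ι × (ι → RelAut T) => petalAut T x.1 x.2) := by
  rintro ⟨σ, g⟩ ⟨τ, h⟩ heq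
  have key : ∀ i a, (σ i, (g i).1 a) = (τ i, (h i).1 a) := by
    intro i a
    have := DFunLike.congr_fun heq (Sum.inr (i, a))
    exact Sum.inr_injective this
  have hσ : σ = τ := by
    ext i
    obtain ⟨a⟩ := ‹Nonempty α›
    exact congrArg Prod.fst (key i a)
  have hg : g = h := by
    funext i
    apply Subtype.ext
    ext a
    exact congrArg Prod.snd (key i a)
  rw [hσ, hg]

/-- Every edge of `T` has an end outside the core, so its copies in different petals are different
edges. -/
lemma card_edgeSet_petalGraph_le [Finite α] [Finite β] [Finite ι] (T : SimpleGraph (β ⊕ α))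
    (hT : ∀ b b', ¬ T.Adj (Sum.inl b) (Sum.inl b')) :
    Nat.card ι * Nat.card T.edgeSet ≤ Nat.card (petalGraph T ι).edgeSet := by
  rw [← Nat.card_prod]
  have hmem : ∀ x : ι × T.edgeSet,
      Sym2.map (Sum.map id (fun a => (x.1, a))) x.2.1 ∈ (petalGraph T ι).edgeSet := by
    rintro ⟨i, ⟨e, he⟩⟩
    induction e with | _ u v =>
    simp only [SimpleGraph.mem_edgeSet] at he
    simp only [Sym2.map_mk, SimpleGraph.mem_edgeSet]
    refine ⟨?_, ?_⟩
    · rcases u with u | u <;> rcases v with v | v <;> simpa using he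
    · rcases u with u | u <;> rcases v with v | v <;> simp
      rintro _ _ _ _ rfl _ rfl _
      rfl
  refine Nat.card_le_card_of_injective (fun x => ⟨_, hmem x⟩) ?_
  rintro ⟨i, ⟨e, he⟩⟩ ⟨j, ⟨e', he'⟩⟩ heq
  have heq : Sym2.map (Sum.map id (fun a => (i, a))) e = Sym2.map (Sum.map id (fun a => (j, a))) e' :=
    congrArg Subtype.val heq
  have h1 : e = e' := by
    have := congrArg (Sym2.map (Sum.map id Prod.snd)) heq
    have hid : (fun x : β ⊕ α => Sum.map id (fun x => x) x) = id := by
      ext x; rcases x with x | x <;> rfl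
    simpa [Sym2.map_map, Function.comp_def, Sum.map_map, hid] using this
  subst h1
  have h2 : ∃ a, Sum.inr a ∈ e := by
    induction e with | _ u v =>
    rcases u with u | u
    · rcases v with v | v
      · exact absurd he (hT u v)
      · exact ⟨v, Sym2.mem_mk_right _ _⟩
    · exact ⟨u, Sym2.mem_mk_left _ _⟩
  obtain ⟨a, ha⟩ := h2
  have h3 : (Sum.inr (i, a) : β ⊕ ι × α) ∈ Sym2.map (Sum.map id (fun a => (j, a))) e := by
    rw [← heq]
    exact Sym2.mem_map.2 ⟨_, ha, rfl⟩
  obtain ⟨x, -, hx⟩ := Sym2.mem_map.1 h3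
  rcases x with x | x
  · simp at hx
  · simp only [Sum.map_inr, Sum.inr.injEq, Prod.mk.injEq] at hx
    simp [hx.1]

/-- The petals can be permuted, and each can be moved by its own automorphism fixing the core. This
gives `m! * |RelAut T|^m` automorphisms of a graph contained in `H`, which sparsity limits. It is
the only source of upper bounds on the size of disjoint families in `H`. -/
lemma IsSparse.petal_bound {n : ℕ} {q : unitInterval} {V : Type*} {H : SimpleGraph V}
    (hH : IsSparse n q H) [Fintype α] [Nonempty α] [Fintype β] [Fintype ι]
    (T : SimpleGraph (β ⊕ α)) (hT : ∀ b b', ¬ T.Adj (Sum.inl b) (Sum.inl b'))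
    (b : β → V) (f : ι → α → V) (hinj : ∀ i, Function.Injective (Sum.elim b (f i)))
    (hb : Function.Injective b)
    (hhom : ∀ i x y, T.Adj x y → H.Adj (Sum.elim b (f i) x) (Sum.elim b (f i) y))
    (hdisj : ∀ i j a a', f i a = f j a' → i = j) :
    ((Fintype.card ι).factorial : ℝ) * (Nat.card (RelAut T) : ℝ) ^ Fintype.card ι ≤
      (n : ℝ) ^ Fintype.card β *
        ((n : ℝ) ^ Fintype.card α * (q : ℝ) ^ Nat.card T.edgeSet) ^ Fintype.card ι := by
  classical
  let c : (petalGraph T ι).Copy H :=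
    { toHom :=
        { toFun := Sum.elim b (fun x => f x.1 x.2)
          map_rel' := by
            rintro (x | ⟨i, x⟩) (y | ⟨j, y⟩) h
            · exact absurd h.1 (hT x y)
            · exact hhom j (Sum.inl x) (Sum.inr y) h.1
            · exact hhom i (Sum.inr x) (Sum.inl y) h.1
            · obtain rfl : i = j := h.2 i j x y rfl rfl
              exact hhom i (Sum.inr x) (Sum.inr y) h.1 }
      injective' := by
        rintro (x | ⟨i, x⟩) (y | ⟨j, y⟩) h
        · exact congrArg _ (hb h)
        · exact absurd (@hinj j (Sum.inl x) (Sum.inr y) h) (by simp)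
        · exact absurd (@hinj i (Sum.inr x) (Sum.inl y) h) (by simp)
        · obtain rfl : i = j := hdisj i j x y h
          have := @hinj i (Sum.inr x) (Sum.inr y) h
          simpa using this }
  have h1 := hH.card_aut_le c
  have := finite_aut (petalGraph T ι)
  have h2 := Nat.card_le_card_of_injective _ (petalAut_injective (ι := ι) T)
  have h3 : Nat.card (Equiv.Perm ι × (ι → RelAut T)) =
      (Fintype.card ι).factorial * Nat.card (RelAut T) ^ Fintype.card ι := by
    rw [Nat.card_prod, Nat.card_perm, Nat.card_pi]
    simp
  rw [h3] at h2
  have h4 := card_edgeSet_petalGraph_le (ι := ι) T hT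
  rw [Nat.card_eq_fintype_card] at h4
  have hq0 := q.2.1
  have hq1 := q.2.2
  calc _ ≤ (Nat.card (petalGraph T ι ≃g petalGraph T ι) : ℝ) := by exact_mod_cast h2
    _ ≤ _ := h1
    _ ≤ (n : ℝ) ^ Fintype.card (β ⊕ ι × α) *
        (q : ℝ) ^ (Fintype.card ι * Nat.card T.edgeSet) := by
      gcongr ?_ * ?_
      exact pow_le_pow_of_le_one hq0 hq1 h4
    _ = _ := by
      rw [Fintype.card_sum, Fintype.card_prod, pow_add, mul_pow, ← pow_mul, ← pow_mul,
        mul_comm (Fintype.card α), mul_comm (Nat.card T.edgeSet), mul_assoc]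

end Petals

/-! ### Extensions of partial embeddings and their packings. -/

section Extensions

open scoped Classical

variable {U V : Type*} [Fintype U] [Fintype V]

/-- The maps that agree with `φ` off `R` and embed `F[S]` into `H`. -/
noncomputable def extensions (F : SimpleGraph U) (H : SimpleGraph V) (S R : Finset U)
    (φ : U → V) : Finset (U → V) :=
  Finset.univ.filter fun f => (∀ u ∉ R, f u = φ u) ∧ Set.InjOn f S ∧
    ∀ u ∈ S, ∀ v ∈ S, F.Adj u v → H.Adj (f u) (f v)

/-- The edges of `F` inside `S`. -/
noncomputable def edgesIn (F : SimpleGraph U) (S : Finset U) : Finset (Sym2 U) :=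
  F.edgeFinset.filter fun e => ∀ v ∈ e, v ∈ S

/-- The edges of `F` inside `S` that have an endpoint in `R`. -/
noncomputable def edgesTouching (F : SimpleGraph U) (S R : Finset U) : Finset (Sym2 U) :=
  (edgesIn F S).filter fun e => ∃ v ∈ e, v ∈ R

variable {F : SimpleGraph U} {H : SimpleGraph V} {S R : Finset U} {φ f : U → V}

lemma mem_extensions : f ∈ extensions F H S R φ ↔ (∀ u ∉ R, f u = φ u) ∧ Set.InjOn f S ∧
    ∀ u ∈ S, ∀ v ∈ S, F.Adj u v → H.Adj (f u) (f v) := by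
  simp [extensions]

lemma mk_mem_edgesIn {u v : U} : s(u, v) ∈ edgesIn F S ↔ F.Adj u v ∧ u ∈ S ∧ v ∈ S := by
  simp [edgesIn]

lemma mk_mem_edgesTouching {u v : U} :
    s(u, v) ∈ edgesTouching F S R ↔ F.Adj u v ∧ (u ∈ S ∧ v ∈ S) ∧ (u ∈ R ∨ v ∈ R) := by
  simp [edgesTouching, mk_mem_edgesIn, and_assoc]

lemma card_edgesIn_eq (F : SimpleGraph U) (S R : Finset U) :
    (edgesIn F S).card = (edgesIn F (S \ R)).card + (edgesTouching F S R).card := by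
  rw [edgesTouching, ← Finset.card_filter_add_card_filter_not (s := edgesIn F S)
    (fun e => ∃ v ∈ e, v ∈ R), add_comm]
  congr 2
  ext e
  induction e with | _ u v =>
  simp [mk_mem_edgesIn]
  tauto

lemma edgesTouching_empty : edgesTouching F S ∅ = ∅ := by
  simp [edgesTouching]

lemma edgesTouching_mono {R' : Finset U} (h : R ⊆ R') :
    edgesTouching F S R ⊆ edgesTouching F S R' := by
  intro e
  induction e with | _ u v =>
  simp only [mk_mem_edgesTouching]
  exact fun ⟨h1, h2, h3⟩ => ⟨h1, h2, h3.imp (@h _) (@h _)⟩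

/-- Embedding in two stages. -/
lemma card_extensions_le_mul {A A' : Finset U} (φ : U → V) {a b : ℝ}
    (hb0 : 0 ≤ b) (ha : ((extensions F H (S \ A') A φ).card : ℝ) ≤ a)
    (hb : ∀ ψ, ((extensions F H S A' ψ).card : ℝ) ≤ b) :
    ((extensions F H S (A ∪ A') φ).card : ℝ) ≤ a * b := by
  let ρ : (U → V) → U → V := fun f u => if u ∈ A then f u else φ u
  have hmaps : ∀ f ∈ extensions F H S (A ∪ A') φ, ρ f ∈ extensions F H (S \ A') A φ := by
    intro f hf
    rw [mem_extensions] at hf ⊢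
    have hagree : ∀ u ∈ S \ A', ρ f u = f u := by
      intro u hu
      by_cases hA : u ∈ A
      · simp [ρ, hA]
      · have : u ∉ A ∪ A' := by
          simp only [Finset.mem_sdiff] at hu
          simp [hA, hu.2]
        simp [ρ, hA, hf.1 u this]
    refine ⟨fun u hu => by simp [ρ, hu], ?_, ?_⟩
    · intro u hu v hv huv
      rw [hagree u hu, hagree v hv] at huv
      exact hf.2.1 (Finset.mem_sdiff.1 hu).1 (Finset.mem_sdiff.1 hv).1 huv
    · intro u hu v hv huv
      rw [hagree u hu, hagree v hv]
      exact hf.2.2 u (Finset.mem_sdiff.1 hu).1 v (Finset.mem_sdiff.1 hv).1 huv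
  rw [Finset.card_eq_sum_card_fiberwise hmaps]
  push_cast
  calc _ ≤ ∑ _g ∈ extensions F H (S \ A') A φ, b := by
        refine Finset.sum_le_sum fun g hg => (Nat.cast_le.2 (Finset.card_le_card ?_)).trans (hb g)
        intro f hf'
        obtain ⟨hf, rfl⟩ := Finset.mem_filter.1 hf'
        rw [mem_extensions] at hf ⊢
        refine ⟨fun u hu => ?_, hf.2⟩
        by_cases hA : u ∈ A
        · simp [ρ, hA]
        · simp [ρ, hA, hf.1 u (by simp [hA, hu])]
    _ ≤ a * b := by
        rw [Finset.sum_const, nsmul_eq_mul]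
        gcongr

lemma card_extensions_empty_le (φ : U → V) : (extensions F H S ∅ φ).card ≤ 1 := by
  refine Finset.card_le_one.2 fun f hf g hg => ?_
  rw [mem_extensions] at hf hg
  ext u
  rw [hf.1 u (by simp), hg.1 u (by simp)]

lemma card_extensions_le_pow (φ : U → V) :
    (extensions F H S R φ).card ≤ Fintype.card V ^ R.card := by
  have : (extensions F H S R φ).card ≤ Fintype.card (R → V) := by
    rw [← Finset.card_univ]
    refine Finset.card_le_card_of_injOn (fun f u => f u) (fun _ _ => Finset.mem_univ _) ?_
    intro f hf g hg h
    rw [Finset.mem_coe, mem_extensions] at hf hg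
    ext u
    by_cases hu : u ∈ R
    · exact congrFun h ⟨u, hu⟩
    · rw [hf.1 u hu, hg.1 u hu]
  simpa using this

lemma extensions_self_mono {S' : Finset U} (h : S' ⊆ S) (φ : U → V) :
    extensions F H S R φ ⊆ extensions F H S' R φ := by
  intro f hf
  rw [mem_extensions] at hf ⊢
  exact ⟨hf.1, hf.2.1.mono (by exact_mod_cast h), fun u hu v hv => hf.2.2 u (h hu) v (h hv)⟩

/-- The vertices of `S \ R` that have a neighbour in `R`. -/
noncomputable def outerBoundary (F : SimpleGraph U) (S R : Finset U) : Finset U :=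
  (S \ R).filter fun b => ∃ r ∈ R, F.Adj b r

lemma mem_outerBoundary {b : U} :
    b ∈ outerBoundary F S R ↔ (b ∈ S ∧ b ∉ R) ∧ ∃ r ∈ R, F.Adj b r := by
  simp [outerBoundary]

lemma card_outerBoundary_le (hR : R ⊆ S) :
    (outerBoundary F S R).card ≤ (edgesTouching F S R).card := by
  have : ∀ b ∈ outerBoundary F S R, ∃ r ∈ R, F.Adj b r := fun b hb => (mem_outerBoundary.1 hb).2
  choose! r hr using this
  refine Finset.card_le_card_of_injOn (fun b => s(b, r b)) ?_ ?_
  · intro b hb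
    have h1 := mem_outerBoundary.1 hb
    exact mk_mem_edgesTouching.2 ⟨(hr b hb).2, ⟨h1.1.1, hR (hr b hb).1⟩, Or.inr (hr b hb).1⟩
  · intro b hb b' hb' h
    have h1 := mem_outerBoundary.1 hb
    rcases Sym2.eq_iff.1 h with h | h
    · exact h.1
    · exact absurd (h.1 ▸ (hr b' hb').1) h1.1.2

/-- A family of extensions with disjoint images of `R`. -/
def IsPacking (R : Finset U) (P : Finset (U → V)) : Prop :=
  ∀ f ∈ P, ∀ g ∈ P, ∀ a ∈ R, ∀ a' ∈ R, f a = g a' → f = g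

/-- A packing forms the petals of a flower in `H` whose core is the image of the outer boundary.
Edges of `F` inside the core are dropped, and of the automorphisms only the permutations of the
petals are used. -/
lemma IsSparse.packing_bound {n : ℕ} {q : unitInterval} (hH : IsSparse n q H) (hRS : R ⊆ S)
    (hR : R.Nonempty) {P : Finset (U → V)} (hP : P ⊆ extensions F H S R φ)
    (hP0 : P.Nonempty) (hPack : IsPacking R P) :
    (P.card.factorial : ℝ) ≤ (n : ℝ) ^ (outerBoundary F S R).card *
      ((n : ℝ) ^ R.card * (q : ℝ) ^ (edgesTouching F S R).card) ^ P.card := by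
  obtain ⟨f₀, hf₀⟩ := hP0
  have hφ := (mem_extensions.1 (hP hf₀))
  have : Nonempty R := hR.to_subtype
  let val : outerBoundary F S R ⊕ R → U := Sum.elim Subtype.val Subtype.val
  have hvalS : ∀ x, val x ∈ S := by
    rintro (x | x)
    · exact (mem_outerBoundary.1 x.2).1.1
    · exact hRS x.2
  have hval : Function.Injective val := by
    rintro (x | x) (y | y) h
    · exact congrArg _ (Subtype.ext h)
    · exact absurd y.2 (show y.1 ∉ R from (show x.1 = y.1 from h) ▸ (mem_outerBoundary.1 x.2).1.2)
    · exact absurd x.2 (show x.1 ∉ R from (show x.1 = y.1 from h) ▸ (mem_outerBoundary.1 y.2).1.2)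
    · exact congrArg _ (Subtype.ext h)
  let T : SimpleGraph (outerBoundary F S R ⊕ R) :=
    { Adj := fun x y => F.Adj (val x) (val y) ∧ (val x ∈ R ∨ val y ∈ R)
      symm := ⟨fun _ _ h => ⟨h.1.symm, h.2.symm⟩⟩
      loopless := ⟨fun _ h => F.loopless.irrefl _ h.1⟩ }
  have hT : ∀ b b', ¬ T.Adj (Sum.inl b) (Sum.inl b') := by
    rintro b b' ⟨-, h | h⟩
    · exact (mem_outerBoundary.1 b.2).1.2 h
    · exact (mem_outerBoundary.1 b'.2).1.2 h
  have hext : ∀ i : P, ∀ x, Sum.elim (fun b : outerBoundary F S R => φ b) (fun a : R => i.1 a) x =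
      i.1 (val x) := by
    rintro i (x | x)
    · exact ((mem_extensions.1 (hP i.2)).1 x (mem_outerBoundary.1 x.2).1.2).symm
    · rfl
  have key := hH.petal_bound (ι := P) T hT (fun b => φ b) (fun i a => i.1 a) (fun i x y hxy => by
      rw [hext, hext] at hxy
      exact hval ((mem_extensions.1 (hP i.2)).2.1 (hvalS x) (hvalS y) hxy))
    (fun x y hxy => by
      have h1 := hext ⟨f₀, hf₀⟩ (Sum.inl x)
      have h2 := hext ⟨f₀, hf₀⟩ (Sum.inl y)
      simp only [Sum.elim_inl] at h1 h2
      have hxy : φ x = φ y := hxy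
      rw [h1, h2] at hxy
      have := hval (hφ.2.1 (hvalS _) (hvalS _) hxy)
      simpa using this)
    (fun i x y hxy => by
      rw [hext, hext]
      exact (mem_extensions.1 (hP i.2)).2.2 _ (hvalS x) _ (hvalS y) hxy.1)
    (fun i j a a' h => Subtype.ext (hPack i.1 i.2 j.1 j.2 a a.2 a' a'.2 h))
  have hedge : (edgesTouching F S R).card ≤ Nat.card T.edgeSet := by
    rw [Nat.card_eq_fintype_card, ← SimpleGraph.edgeFinset_card]
    refine (Finset.card_le_card ?_).trans (Finset.card_image_le (f := Sym2.map val))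
    intro e
    induction e with | _ u v =>
    intro he
    rw [mk_mem_edgesTouching] at he
    have hlift : ∀ u v : U, u ∈ S → v ∈ S → F.Adj u v → u ∈ R ∨ v ∈ R → ∃ x, val x = u := by
      intro u v hu hv huv h
      by_cases huR : u ∈ R
      · exact ⟨Sum.inr ⟨u, huR⟩, rfl⟩
      · exact ⟨Sum.inl ⟨u, mem_outerBoundary.2 ⟨⟨hu, huR⟩, v, h.resolve_left huR, huv⟩⟩, rfl⟩
    obtain ⟨x, hx⟩ := hlift u v he.2.1.1 he.2.1.2 he.1 he.2.2
    obtain ⟨y, hy⟩ := hlift v u he.2.1.2 he.2.1.1 he.1.symm he.2.2.symm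
    refine Finset.mem_image.2 ⟨s(x, y), ?_, by simp [hx, hy]⟩
    rw [SimpleGraph.mem_edgeFinset, SimpleGraph.mem_edgeSet]
    exact ⟨by rw [hx, hy]; exact he.1, by rw [hx, hy]; exact he.2.2⟩
  have hone : (1 : ℝ) ≤ (Nat.card (RelAut T) : ℝ) ^ Fintype.card P := by
    apply one_le_pow₀
    have : Nonempty (RelAut T) := ⟨⟨1, by simp⟩⟩
    exact_mod_cast Nat.card_pos (α := RelAut T)
  have hq0 := q.2.1
  have hq1 := q.2.2
  have hcard : Fintype.card P = P.card := Fintype.card_coe P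
  calc (P.card.factorial : ℝ) ≤ _ := by
        rw [← hcard]; exact le_mul_of_one_le_right (by positivity) hone
    _ ≤ _ := key
    _ ≤ _ := by
        rw [Fintype.card_coe, Fintype.card_coe, Fintype.card_coe]
        gcongr ?_ * (?_ * ?_) ^ _
        exact pow_le_pow_of_le_one hq0 hq1 hedge

end Extensions

/-! ### Weights and closed vertex sets. -/

section Weights

open scoped Classical

variable {U V : Type*} [Fintype U] [Fintype V]

/-- The expected number of labelled copies of `F[S]`, up to lower order factors. -/
noncomputable def weight (x y : ℝ) (F : SimpleGraph U) (S : Finset U) : ℝ :=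
  x ^ S.card * y ^ (edgesIn F S).card

/-- The expected number of ways to extend a copy of `F[S \ R]` to one of `F[S]`. -/
noncomputable def relWeight (x y : ℝ) (F : SimpleGraph U) (S R : Finset U) : ℝ :=
  x ^ R.card * y ^ (edgesTouching F S R).card

variable {F : SimpleGraph U} {H : SimpleGraph V} {S R : Finset U} {φ f : U → V} {x y : ℝ}
  {n : ℕ} {q : unitInterval}

lemma weight_eq_mul (hR : R ⊆ S) :
    weight x y F S = weight x y F (S \ R) * relWeight x y F S R := by
  rw [weight, weight, relWeight, card_edgesIn_eq F S R, pow_add,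
    ← Finset.card_sdiff_add_card_eq_card hR, pow_add]
  ring

lemma IsSparse.one_le_weight (hH : IsSparse n q H) (c : F.Copy H) (S : Finset U) :
    1 ≤ weight n q F S := by
  have h1 := hH.card_aut_le (c.comp (SimpleGraph.Copy.induce F (S : Set U)))
  have h2 : (1 : ℝ) ≤ Nat.card (F.induce (S : Set U) ≃g F.induce (S : Set U)) := by
    exact_mod_cast card_aut_pos (F.induce (S : Set U))
  have hedge : (edgesIn F S).card ≤ Nat.card (F.induce (S : Set U)).edgeSet := by
    rw [Nat.card_eq_fintype_card, ← SimpleGraph.edgeFinset_card]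
    refine (Finset.card_le_card ?_).trans (Finset.card_image_le (f := Sym2.map Subtype.val))
    intro e
    induction e with | _ u v =>
    intro he
    rw [mk_mem_edgesIn] at he
    refine Finset.mem_image.2 ⟨s(⟨u, he.2.1⟩, ⟨v, he.2.2⟩), ?_, by simp⟩
    rw [SimpleGraph.mem_edgeFinset, SimpleGraph.mem_edgeSet]
    exact he.1
  have hq0 := q.2.1
  have hq1 := q.2.2
  refine (h2.trans h1).trans ?_
  rw [weight]
  have hc : Fintype.card (S : Set U) = S.card := by simp
  rw [hc]
  gcongr ?_ * ?_
  exact pow_le_pow_of_le_one hq0 hq1 hedge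

/-- This is why weights are taken at `2q` instead of `q`: a bound on the weight of `S` then bounds
the number of edges inside `S` by a logarithm. -/
lemma IsSparse.two_pow_le_weight (hH : IsSparse n q H) (c : F.Copy H) (S : Finset U) :
    (2 : ℝ) ^ (edgesIn F S).card ≤ weight n (2 * q) F S := by
  have := hH.one_le_weight c S
  rw [weight, mul_pow]
  rw [weight] at this
  nlinarith [show (0 : ℝ) < 2 ^ (edgesIn F S).card by positivity]

/-- Every set of vertices has a small superset all of whose extensions increase the weight. -/
lemma exists_closure (hH : IsSparse n q H) (hq : 2 * (q : ℝ) ≤ 1) (Y : Finset V) :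
    ∃ X, Y ⊆ X ∧ (2 : ℝ) ^ (edgesIn H X).card ≤ (n : ℝ) ^ Y.card ∧
      ∀ X', X ⊂ X' → weight n (2 * q) H X < weight n (2 * q) H X' := by
  obtain ⟨X₀, hX₀, hmin⟩ := Finset.exists_min_image (Finset.univ.filter fun X => Y ⊆ X)
    (weight n (2 * q) H) ⟨Y, by simp⟩
  -- Among the sets of minimum weight one of largest cardinality is taken, which makes the
  -- inequality for proper supersets strict.
  obtain ⟨X, hX, hmax⟩ := Finset.exists_max_image
    (Finset.univ.filter fun X => Y ⊆ X ∧ weight n (2 * q) H X ≤ weight n (2 * q) H X₀)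
    Finset.card ⟨X₀, by simpa using hX₀⟩
  simp only [Finset.mem_filter, Finset.mem_univ, true_and] at hX₀ hmin hX hmax
  refine ⟨X, hX.1, ?_, ?_⟩
  · refine (hH.two_pow_le_weight (SimpleGraph.Copy.id H) X).trans (hX.2.trans
      ((hmin Y (Finset.Subset.refl Y)).trans ?_))
    have hq0 := q.2.1
    exact mul_le_of_le_one_right (by positivity) (pow_le_one₀ (by positivity) hq)
  · intro X' hX'
    by_contra hle
    exact absurd (Finset.card_lt_card hX')
      (not_lt.2 (hmax X' ⟨hX.1.trans hX'.1, (not_lt.1 hle).trans hX.2⟩))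

lemma sym2_map_injOn {s : Set U} (hf : Set.InjOn f s) {e e' : Sym2 U} (he : ∀ v ∈ e, v ∈ s)
    (he' : ∀ v ∈ e', v ∈ s) (h : Sym2.map f e = Sym2.map f e') : e = e' := by
  induction e with | _ u v =>
  induction e' with | _ u' v' =>
  simp only [Sym2.mem_iff, forall_eq_or_imp, forall_eq] at he he'
  simp only [Sym2.map_mk, Sym2.eq_iff] at h ⊢
  rcases h with h | h
  · exact Or.inl ⟨hf he.1 he'.1 h.1, hf he.2 he'.2 h.2⟩
  · exact Or.inr ⟨hf he.1 he'.2 h.1, hf he.2 he'.1 h.2⟩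

lemma mem_of_mem_edgesTouching {e : Sym2 U} (he : e ∈ edgesTouching F S R) : ∀ v ∈ e, v ∈ S := by
  rw [edgesTouching, edgesIn] at he
  simp only [Finset.mem_filter] at he
  exact he.1.2

lemma card_image_edgesTouching (hf : Set.InjOn f S) :
    ((edgesTouching F S R).image (Sym2.map f)).card = (edgesTouching F S R).card := by
  refine Finset.card_image_of_injOn fun e he e' he' h => ?_
  exact sym2_map_injOn hf (fun v hv => mem_of_mem_edgesTouching he v hv)
    (fun v hv => mem_of_mem_edgesTouching he' v hv) h

lemma mem_or_mem_outerBoundary {u v : U} (h : s(u, v) ∈ edgesTouching F S R) :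
    u ∈ R ∨ u ∈ outerBoundary F S R := by
  rw [mk_mem_edgesTouching] at h
  by_cases hu : u ∈ R
  · exact Or.inl hu
  · exact Or.inr (mem_outerBoundary.2 ⟨⟨h.2.1.1, hu⟩, v, h.2.2.resolve_left hu, h.1⟩)

/-- Let `T` be the set of vertices of `R` sent outside `X`. Adding the image of `T` to `X` brings in
at least the images of all edges touching `T`, so the weight is multiplied by at most `relWeight x y
F S T ≤ 1`. The choice of `X` forbids this unless `T` is empty. -/
lemma mem_of_closed (hx : 0 ≤ x) (hy0 : 0 ≤ y) (hy1 : y ≤ 1) {X : Finset V}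
    (hX : ∀ X', X ⊂ X' → weight x y H X < weight x y H X') (hRS : R ⊆ S)
    (hw : ∀ T ⊆ R, relWeight x y F S T ≤ 1) (hf : f ∈ extensions F H S R φ)
    (hφ : ∀ b ∈ outerBoundary F S R, φ b ∈ X) : ∀ r ∈ R, f r ∈ X := by
  by_contra! hcon
  obtain ⟨hfφ, hinj, hhom⟩ := mem_extensions.1 hf
  set T := R.filter fun r => f r ∉ X with hT
  have hTR : T ⊆ R := Finset.filter_subset _ _
  have hTS : T ⊆ S := hTR.trans hRS
  set X' := X ∪ T.image f with hX'
  have hdisj : Disjoint X (T.image f) := by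
    rw [Finset.disjoint_right]
    intro z hz
    obtain ⟨t, ht, rfl⟩ := Finset.mem_image.1 hz
    exact (Finset.mem_filter.1 ht).2
  have hss : X ⊂ X' := by
    obtain ⟨r, hr, hrX⟩ := hcon
    refine ⟨Finset.subset_union_left, fun h => hrX (h ?_)⟩
    exact Finset.mem_union_right _ (Finset.mem_image_of_mem f (Finset.mem_filter.2 ⟨hr, hrX⟩))
  have hcard : X'.card = X.card + T.card := by
    rw [hX', Finset.card_union_of_disjoint hdisj, Finset.card_image_of_injOn]
    exact hinj.mono (by exact_mod_cast hTS)
  have hsub : edgesIn H X ∪ (edgesTouching F S T).image (Sym2.map f) ⊆ edgesIn H X' := by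
    refine Finset.union_subset ?_ ?_
    · intro e
      induction e with | _ u v =>
      simp only [mk_mem_edgesIn]
      exact fun ⟨h1, h2, h3⟩ => ⟨h1, hss.1 h2, hss.1 h3⟩
    · intro e' he'
      obtain ⟨e, he, rfl⟩ := Finset.mem_image.1 he'
      have hmemX' : ∀ u v, s(u, v) ∈ edgesTouching F S T → f u ∈ X' := by
        intro u v huv
        rcases mem_or_mem_outerBoundary (edgesTouching_mono hTR huv) with hu | hu
        · by_cases huX : f u ∈ X
          · exact hss.1 huX
          · exact Finset.mem_union_right _
              (Finset.mem_image_of_mem f (Finset.mem_filter.2 ⟨hu, huX⟩))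
        · rw [hfφ u (mem_outerBoundary.1 hu).1.2]
          exact hss.1 (hφ u hu)
      induction e with | _ u v =>
      have h := mk_mem_edgesTouching.1 he
      rw [Sym2.map_mk, mk_mem_edgesIn]
      exact ⟨hhom u h.2.1.1 v h.2.1.2 h.1, hmemX' u v he, hmemX' v u (by rwa [Sym2.eq_swap])⟩
  have hdisj' : Disjoint (edgesIn H X) ((edgesTouching F S T).image (Sym2.map f)) := by
    rw [Finset.disjoint_right]
    intro e' he'
    obtain ⟨e, he, rfl⟩ := Finset.mem_image.1 he'
    induction e with | _ u v =>
    have h := mk_mem_edgesTouching.1 he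
    rw [Sym2.map_mk, mk_mem_edgesIn]
    rintro ⟨-, h1, h2⟩
    rcases h.2.2 with h3 | h3
    · exact (Finset.mem_filter.1 h3).2 h1
    · exact (Finset.mem_filter.1 h3).2 h2
  have hedge : (edgesIn H X).card + (edgesTouching F S T).card ≤ (edgesIn H X').card := by
    rw [← card_image_edgesTouching (hinj), ← Finset.card_union_of_disjoint hdisj']
    exact Finset.card_le_card hsub
  have hlt := hX X' hss
  have : weight x y H X' ≤ weight x y H X * relWeight x y F S T := by
    rw [weight, weight, relWeight, hcard]
    calc _ ≤ x ^ (X.card + T.card) * y ^ ((edgesIn H X).card + (edgesTouching F S T).card) := by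
          gcongr ?_ * ?_
          exact pow_le_pow_of_le_one hy0 hy1 hedge
      _ = _ := by rw [pow_add, pow_add]; ring
  have hw0 : 0 ≤ weight x y H X := by rw [weight]; positivity
  have := mul_le_of_le_one_right hw0 (hw T hTR)
  linarith

end Weights

/-! ### Counting extensions through the images of edges. -/

section EdgeImages

open scoped Classical

variable {U V : Type*} [Fintype U] [Fintype V]
variable {F : SimpleGraph U} {H : SimpleGraph V} {S R : Finset U} {φ f : U → V}

/-- `R` cannot be split into two nonempty parts without edges of `F` between them. -/
def IsUnsplit (F : SimpleGraph U) (R : Finset U) : Prop :=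
  ∀ A ⊂ R, A.Nonempty → ∃ a ∈ A, ∃ r ∈ R \ A, F.Adj a r

lemma card_vertices_le (D : Finset (Sym2 V)) :
    (Finset.univ.filter fun v : V => ∃ e ∈ D, v ∈ e).card ≤ 2 * D.card := by
  have : (Finset.univ.filter fun v : V => ∃ e ∈ D, v ∈ e) = D.biUnion Sym2.toFinset := by
    ext v; simp
  rw [this, mul_comm]
  refine Finset.card_biUnion_le_card_mul _ _ _ fun e _ => ?_
  rw [Sym2.card_toFinset]
  split <;> omega

/-- Few maps send the edges at `R` onto a given set of edges. -/
lemma card_le_of_edge_image (hRS : R ⊆ S) (hconn : IsUnsplit F R) {d : ℕ}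
    (hdeg : ∀ r ∈ R, F.degree r ≤ d) (hedge : (edgesTouching F S R).Nonempty) (D : Finset (Sym2 V))
    (Φ : Finset (U → V)) (hΦ : ∀ f ∈ Φ, f ∈ extensions F H S R φ)
    (hD : ∀ f ∈ Φ, (edgesTouching F S R).image (Sym2.map f) = D) :
    Φ.card ≤ 2 * D.card * d ^ (R.card - 1) := by
  let ρ : Finset U → (U → V) → U → V := fun A f u => if u ∈ A then f u else φ u
  -- The values on `R` are revealed along a growing set `A`. The first vertex lies on an edge of
  -- `D`, so it has at most `2 |D|` possible images. A later `r` has a neighbour `a` in `A`. If `f`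
  -- and `f₀` agree on `A`, the edge `f a f r` of `D` is also the image under `f₀` of an edge at
  -- `a`, so `f r` is the value of `f₀` at one of the at most `d` neighbours of `a`.
  have claim : ∀ m, m + 1 ≤ R.card → ∃ A ⊆ R, A.card = m + 1 ∧
      (Φ.image (ρ A)).card ≤ 2 * D.card * d ^ m := by
    intro m
    induction m with
    | zero =>
      intro _
      have : ∃ r ∈ R, ∃ v, s(r, v) ∈ edgesTouching F S R := by
        obtain ⟨e, he⟩ := hedge
        induction e with | _ u v =>
        rcases (mk_mem_edgesTouching.1 he).2.2 with h | h
        · exact ⟨u, h, v, he⟩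
        · exact ⟨v, h, u, by rwa [Sym2.eq_swap]⟩
      obtain ⟨r, hr, v, hv⟩ := this
      refine ⟨{r}, by simpa using hr, by simp, ?_⟩
      rw [pow_zero, mul_one]
      refine le_trans ?_ (card_vertices_le D)
      refine Finset.card_le_card_of_injOn (fun g => g r) ?_ ?_
      · intro g hg
        obtain ⟨f, hf, rfl⟩ := Finset.mem_image.1 (Finset.mem_coe.1 hg)
        simp only [Finset.coe_filter, Finset.mem_univ, true_and, Set.mem_ofPred_eq]
        refine ⟨Sym2.map f s(r, v), ?_, ?_⟩
        · rw [← hD f hf]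
          exact Finset.mem_image_of_mem _ hv
        · simp [ρ]
      · intro g hg g' hg' h
        obtain ⟨f, hf, rfl⟩ := Finset.mem_image.1 (Finset.mem_coe.1 hg)
        obtain ⟨f', hf', rfl⟩ := Finset.mem_image.1 (Finset.mem_coe.1 hg')
        ext u
        by_cases hu : u = r
        · rw [hu]; exact h
        · simp [ρ, hu]
    | succ m ih =>
      intro hm
      obtain ⟨A, hAR, hA, hcard⟩ := ih (by omega)
      obtain ⟨a, ha, r, hr, har⟩ := hconn A ⟨hAR, fun h => by
        have := Finset.card_le_card h; omega⟩ (Finset.card_pos.1 (by omega))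
      rw [Finset.mem_sdiff] at hr
      refine ⟨insert r A, Finset.insert_subset hr.1 hAR, by
        rw [Finset.card_insert_of_notMem hr.2, hA], ?_⟩
      have hρρ : ∀ f, ρ A (ρ (insert r A) f) = ρ A f := by
        intro f
        ext u
        by_cases hu : u ∈ A <;> simp [ρ, hu]
      have himage : (Φ.image (ρ (insert r A))).image (ρ A) = Φ.image (ρ A) := by
        rw [Finset.image_image]
        exact Finset.image_congr fun f _ => hρρ f
      refine (Finset.card_le_mul_card_image (f := ρ A) _ d ?_).trans ?_
      · rw [himage]
        intro g hg
        obtain ⟨f₀, hf₀, rfl⟩ := Finset.mem_image.1 hg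
        refine le_trans ?_ (hdeg a (hAR ha))
        rw [← SimpleGraph.card_neighborFinset_eq_degree]
        refine le_trans ?_ (Finset.card_image_le (f := f₀))
        refine Finset.card_le_card_of_injOn (fun g => g r) ?_ ?_
        · intro h hh
          obtain ⟨hh1, hh2⟩ := Finset.mem_filter.1 (Finset.mem_coe.1 hh)
          obtain ⟨f, hf, rfl⟩ := Finset.mem_image.1 hh1
          rw [hρρ] at hh2
          have hfa : f a = f₀ a := by
            have := congrFun hh2 a
            simpa [ρ, ha] using this
          have hmem : Sym2.map f s(a, r) ∈ D := by
            rw [← hD f hf]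
            exact Finset.mem_image_of_mem _
              (mk_mem_edgesTouching.2 ⟨har, ⟨hRS (hAR ha), hRS hr.1⟩, Or.inr hr.1⟩)
          rw [← hD f₀ hf₀] at hmem
          obtain ⟨e, he, heq⟩ := Finset.mem_image.1 hmem
          have hinj := (mem_extensions.1 (hΦ f₀ hf₀)).2.1
          rw [Finset.mem_coe, Finset.mem_image]
          induction e with | _ u v =>
          have he' := mk_mem_edgesTouching.1 he
          simp only [Sym2.map_mk, hfa] at heq
          rcases Sym2.eq_iff.1 heq with h' | h'
          · have : u = a := hinj he'.2.1.1 (hRS (hAR ha)) h'.1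
            subst this
            exact ⟨v, by simpa using he'.1, by simpa [ρ] using h'.2⟩
          · have : v = a := hinj he'.2.1.2 (hRS (hAR ha)) h'.2
            subst this
            exact ⟨u, by simpa using he'.1.symm, by simpa [ρ] using h'.1⟩
        · intro h hh h' hh' hr'
          obtain ⟨hh1, hh2⟩ := Finset.mem_filter.1 (Finset.mem_coe.1 hh)
          obtain ⟨hh1', hh2'⟩ := Finset.mem_filter.1 (Finset.mem_coe.1 hh')
          obtain ⟨f, hf, rfl⟩ := Finset.mem_image.1 hh1
          obtain ⟨f', hf', rfl⟩ := Finset.mem_image.1 hh1'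
          rw [hρρ] at hh2 hh2'
          have heq := hh2.trans hh2'.symm
          ext u
          by_cases hu : u = r
          · rw [hu]; exact hr'
          · by_cases huA : u ∈ A
            · have := congrFun heq u
              simpa [ρ, huA] using this
            · simp [ρ, huA, hu]
      · rw [himage, pow_succ]
        calc _ ≤ d * (2 * D.card * d ^ m) := by gcongr
          _ = _ := by ring
  rcases Nat.eq_zero_or_pos R.card with h0 | h0
  · rw [Finset.card_eq_zero] at h0
    subst h0
    simp [edgesTouching_empty] at hedge
  · obtain ⟨A, hAR, hA, hcard⟩ := claim (R.card - 1) (by omega)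
    obtain rfl : A = R := Finset.eq_of_subset_of_card_le hAR (by omega)
    have : Φ.image (ρ A) = Φ := by
      conv_rhs => rw [← Finset.image_id (s := Φ)]
      refine Finset.image_congr fun f hf => ?_
      ext u
      by_cases hu : u ∈ A
      · simp [ρ, hu]
      · simp [ρ, hu, (mem_extensions.1 (hΦ f hf)).1 u hu]
    rwa [this] at hcard

/-- An extension with all relevant values in `X` sends the edges touching `R` to equally many edges
of `H[X]`. The binomial coefficient counts the possible sets of images, the other factor the maps
with a given one. -/
lemma card_extensions_into_le (hRS : R ⊆ S) (hconn : IsUnsplit F R) {d : ℕ}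
    (hdeg : ∀ r ∈ R, F.degree r ≤ d) (hedge : (edgesTouching F S R).Nonempty) (X : Finset V)
    (hX : ∀ f ∈ extensions F H S R φ, ∀ r ∈ R, f r ∈ X)
    (hφ : ∀ b ∈ outerBoundary F S R, φ b ∈ X) :
    (extensions F H S R φ).card ≤ (edgesIn H X).card.choose (edgesTouching F S R).card *
      (2 * (edgesTouching F S R).card * d ^ (R.card - 1)) := by
  have hmaps : ∀ f ∈ extensions F H S R φ, (edgesTouching F S R).image (Sym2.map f) ∈
      (edgesIn H X).powersetCard (edgesTouching F S R).card := by
    intro f hf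
    have hf' := mem_extensions.1 hf
    rw [Finset.mem_powersetCard]
    refine ⟨?_, card_image_edgesTouching hf'.2.1⟩
    intro e' he'
    obtain ⟨e, he, rfl⟩ := Finset.mem_image.1 he'
    have hmem : ∀ u v, s(u, v) ∈ edgesTouching F S R → f u ∈ X := by
      intro u v huv
      rcases mem_or_mem_outerBoundary huv with hu | hu
      · exact hX f hf u hu
      · rw [hf'.1 u (mem_outerBoundary.1 hu).1.2]
        exact hφ u hu
    induction e with | _ u v =>
    have h := mk_mem_edgesTouching.1 he
    rw [Sym2.map_mk, mk_mem_edgesIn]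
    exact ⟨hf'.2.2 u h.2.1.1 v h.2.1.2 h.1, hmem u v he, hmem v u (by rwa [Sym2.eq_swap])⟩
  rw [Finset.card_eq_sum_card_fiberwise hmaps]
  refine (Finset.sum_le_card_nsmul _ _ (2 * (edgesTouching F S R).card * d ^ (R.card - 1))
    fun D hD => ?_).trans ?_
  · rw [← (Finset.mem_powersetCard.1 hD).2]
    exact card_le_of_edge_image hRS hconn hdeg hedge D _
      (fun f hf => (Finset.mem_filter.1 hf).1) (fun f hf => (Finset.mem_filter.1 hf).2)
  · rw [Finset.card_powersetCard, smul_eq_mul]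

end EdgeImages

/-! ### Elementary estimates. -/

section Numerics

lemma choose_le_mul_exp_pow {M k : ℕ} {L : ℝ} (hM : (M : ℝ) ≤ k * L) :
    (M.choose k : ℝ) ≤ (Real.exp 1 * L) ^ k := by
  have hfac : (0 : ℝ) < k.factorial := by exact_mod_cast k.factorial_pos
  calc (M.choose k : ℝ) ≤ (M : ℝ) ^ k / k.factorial := Nat.choose_le_pow_div k M
    _ ≤ (k * L) ^ k / k.factorial := by gcongr
    _ = (k : ℝ) ^ k / k.factorial * L ^ k := by rw [mul_pow]; ring
    _ ≤ Real.exp 1 ^ k * L ^ k := by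
        rcases Nat.eq_zero_or_pos k with rfl | hk
        · simp
        have hL : 0 ≤ L := by
          have : (0 : ℝ) < k := by exact_mod_cast hk
          by_contra hL
          have := mul_neg_of_pos_of_neg this (not_le.1 hL)
          have : (0 : ℝ) ≤ M := Nat.cast_nonneg M
          linarith
        gcongr
        rw [← Real.exp_nat_mul, mul_one]
        exact Real.pow_div_factorial_le_exp _ (Nat.cast_nonneg k) k
    _ = _ := by rw [mul_pow]

lemma pow_le_exp_pow_mul_factorial (m : ℕ) :
    (m : ℝ) ^ m ≤ Real.exp 1 ^ m * m.factorial := by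
  have hfac : (0 : ℝ) < m.factorial := by exact_mod_cast m.factorial_pos
  rw [← div_le_iff₀ hfac, ← Real.exp_nat_mul, mul_one]
  exact Real.pow_div_factorial_le_exp _ (Nat.cast_nonneg m) m

lemma two_mul_le_two_pow {k : ℕ} (hk : 1 ≤ k) : 2 * k ≤ 2 ^ k := by
  obtain ⟨k, rfl⟩ := Nat.exists_eq_add_of_le' hk
  rw [pow_succ, mul_comm]
  have := k.lt_two_pow_self
  omega

lemma le_mul_logb_of_two_pow_le {n a b : ℕ} (h : (2 : ℝ) ^ a ≤ (n : ℝ) ^ b) :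
    (a : ℝ) ≤ b * Real.logb 2 n := by
  have := Real.logb_le_logb_of_le (b := 2) (by norm_num) (by positivity) h
  rwa [Real.logb_pow, Real.logb_pow, Real.logb_self_eq_one (by norm_num), mul_one] at this

lemma one_le_logb_two {n : ℕ} (hn : 2 ≤ n) : 1 ≤ Real.logb 2 n := by
  rw [Real.le_logb_iff_rpow_le (by norm_num) (by positivity), Real.rpow_one]
  exact_mod_cast hn

end Numerics

/-! ### Stages that are not expected to gain copies, and maximal packings. -/

section LogBounds

open scoped Classical

variable {U V : Type*} [Fintype U] [Fintype V]
variable {F : SimpleGraph U} {H : SimpleGraph V} {S R : Finset U} {φ f : U → V} {x y : ℝ}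
  {n : ℕ} {q : unitInterval}

/-- A spanning tree of `R` is grown vertex by vertex, each new vertex bringing a new edge. -/
lemma IsUnsplit.card_le (h : IsUnsplit F R) : R.card ≤ (edgesIn F R).card + 1 := by
  have claim : ∀ m, m + 1 ≤ R.card → ∃ A ⊆ R, A.card = m + 1 ∧ m ≤ (edgesIn F A).card := by
    intro m
    induction m with
    | zero =>
      intro h1
      obtain ⟨r, hr⟩ := Finset.card_pos.1 h1
      exact ⟨{r}, by simpa using hr, by simp, Nat.zero_le _⟩
    | succ m ih =>
      intro h1
      obtain ⟨A, hAR, hA, hcard⟩ := ih (by omega)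
      obtain ⟨a, ha, r, hr, har⟩ := h A ⟨hAR, fun h => by
        have := Finset.card_le_card h; omega⟩ (Finset.card_pos.1 (by omega))
      rw [Finset.mem_sdiff] at hr
      refine ⟨insert r A, Finset.insert_subset hr.1 hAR, by
        rw [Finset.card_insert_of_notMem hr.2, hA], ?_⟩
      have hsub : insert s(a, r) (edgesIn F A) ⊆ edgesIn F (insert r A) := by
        refine Finset.insert_subset ?_ ?_
        · rw [mk_mem_edgesIn]
          exact ⟨har, by simp [ha], by simp⟩
        · intro e
          induction e with | _ u v =>
          simp only [mk_mem_edgesIn]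
          exact fun ⟨h1, h2, h3⟩ => ⟨h1, by simp [h2], by simp [h3]⟩
      have := Finset.card_le_card hsub
      rw [Finset.card_insert_of_notMem (by
        rw [mk_mem_edgesIn]; exact fun h => hr.2 h.2.2)] at this
      omega
  rcases Nat.eq_zero_or_pos R.card with h0 | h0
  · omega
  · obtain ⟨A, hAR, hA, hcard⟩ := claim (R.card - 1) (by omega)
    obtain rfl : A = R := Finset.eq_of_subset_of_card_le hAR (by omega)
    omega

lemma card_edgesTouching_union {A A' : Finset U} :
    (edgesTouching F S (A ∪ A')).card =
      (edgesTouching F (S \ A') A).card + (edgesTouching F S A').card := by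
  have h1 := card_edgesIn_eq F S (A ∪ A')
  have h2 := card_edgesIn_eq F S A'
  have h3 := card_edgesIn_eq F (S \ A') A
  rw [sdiff_sdiff_left, Finset.sup_eq_union, Finset.union_comm] at h3
  omega

lemma relWeight_union {A A' : Finset U} (h : Disjoint A A') :
    relWeight x y F S (A ∪ A') = relWeight x y F (S \ A') A * relWeight x y F S A' := by
  rw [relWeight, relWeight, relWeight, card_edgesTouching_union,
    Finset.card_union_of_disjoint h, pow_add, pow_add]
  ring

lemma edgesTouching_eq_edgesIn (hRS : R ⊆ S) (h : outerBoundary F S R = ∅) :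
    edgesTouching F S R = edgesIn F R := by
  ext e
  induction e with | _ u v =>
  constructor
  · intro he
    have h1 := mem_or_mem_outerBoundary he
    have h2 := mem_or_mem_outerBoundary (u := v) (v := u) (by rwa [Sym2.eq_swap])
    simp only [h, Finset.notMem_empty, or_false] at h1 h2
    exact mk_mem_edgesIn.2 ⟨(mk_mem_edgesTouching.1 he).1, h1, h2⟩
  · intro he
    rw [mk_mem_edgesIn] at he
    exact mk_mem_edgesTouching.2 ⟨he.1, ⟨hRS he.2.1, hRS he.2.2⟩, Or.inl he.2.1⟩

/-- The edge saved here pays for an extra logarithm in `card_extensions_le_of_block`. -/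
lemma card_edgesTouching_erase_lt (hRS : R ⊆ S) {b r : U} (hb : b ∈ S) (hbR : b ∉ R) (hr : r ∈ R)
    (hbr : F.Adj b r) :
    (edgesTouching F S (R.erase r)).card < (edgesTouching F S R).card := by
  refine Finset.card_lt_card ((Finset.ssubset_iff_of_subset
    (edgesTouching_mono (Finset.erase_subset _ _))).2 ⟨s(b, r), ?_, ?_⟩)
  · exact mk_mem_edgesTouching.2 ⟨hbr, ⟨hb, hRS hr⟩, Or.inr hr⟩
  · rw [mk_mem_edgesTouching]
    rintro ⟨-, -, h | h⟩
    · exact hbR (Finset.mem_of_mem_erase h)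
    · simp at h

lemma relWeight_pos (hx : 0 < x) (hy : 0 < y) : 0 < relWeight x y F S R := by
  rw [relWeight]; positivity

lemma weight_pos (hx : 0 < x) (hy : 0 < y) : 0 < weight x y F S := by
  rw [weight]; positivity

/-- If no extension from an intermediate stage is expected, then there are few extensions. -/
lemma card_extensions_le_of_relWeight_le_one (hH : IsSparse n q H) (c : F.Copy H) (hn : 2 ≤ n)
    (hq : 2 * (q : ℝ) ≤ 1) (R : Finset U) : ∀ (S : Finset U), R ⊆ S →
    (∀ r ∈ R, (F.degree r : ℝ) ≤ Real.logb 2 n) →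
    (∀ T ⊆ R, relWeight n (2 * q) F S T ≤ 1) →
    R.card ≤ (edgesTouching F S R).card ∧ ∀ φ, ((extensions F H S R φ).card : ℝ) ≤
      (2 * Real.exp 1 * Real.logb 2 n) ^ (edgesTouching F S R).card *
        Real.logb 2 n ^ R.card := by
  induction R using Finset.strongInduction with
  | H R ih =>
  intro S hRS hdeg hw
  set L := Real.logb 2 n with hL
  have hL1 : 1 ≤ L := one_le_logb_two hn
  have hq0 := q.2.1
  rcases R.eq_empty_or_nonempty with rfl | hR
  · refine ⟨by simp, fun φ => ?_⟩
    simp only [edgesTouching_empty, Finset.card_empty, pow_zero, mul_one]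
    exact_mod_cast card_extensions_empty_le φ
  by_cases hconn : IsUnsplit F R
  -- With empty boundary the relative weight of `R` would be its weight, which sparsity makes larger
  -- than 1. The edge to the boundary improves `|R| ≤ e(R) + 1` to `|R| ≤ k`, where `k` is the
  -- number of edges touching `R`.
  · have hbd : (outerBoundary F S R).Nonempty := by
      by_contra hbd
      rw [Finset.not_nonempty_iff_eq_empty] at hbd
      have h1 := hw R (Finset.Subset.refl R)
      rw [relWeight, edgesTouching_eq_edgesIn hRS hbd] at h1
      have h2 := hH.two_pow_le_weight c R
      rw [weight] at h2
      have h3 : (edgesIn F R).card = 0 := by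
        by_contra h0
        have := one_lt_pow₀ (a := (2 : ℝ)) (by norm_num) h0
        linarith
      rw [h3, pow_zero, mul_one] at h1
      have : (1 : ℝ) < (n : ℝ) ^ R.card :=
        one_lt_pow₀ (by exact_mod_cast hn) (Finset.card_pos.2 hR).ne'
      linarith
    obtain ⟨b, hb⟩ := hbd
    obtain ⟨⟨hbS, hbR⟩, r, hr, hbr⟩ := mem_outerBoundary.1 hb
    have hedge : s(b, r) ∈ edgesTouching F S R :=
      mk_mem_edgesTouching.2 ⟨hbr, ⟨hbS, hRS hr⟩, Or.inr hr⟩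
    have hk : 1 ≤ (edgesTouching F S R).card := Finset.card_pos.2 ⟨_, hedge⟩
    constructor
    · have hsub : insert s(b, r) (edgesIn F R) ⊆ edgesTouching F S R := by
        refine Finset.insert_subset hedge ?_
        intro e
        induction e with | _ u v =>
        rw [mk_mem_edgesIn, mk_mem_edgesTouching]
        exact fun h => ⟨h.1, ⟨hRS h.2.1, hRS h.2.2⟩, Or.inl h.2.1⟩
      have := Finset.card_le_card hsub
      rw [Finset.card_insert_of_notMem (by rw [mk_mem_edgesIn]; exact fun h => hbR h.2.1)] at this
      exact hconn.card_le.trans this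
    · intro φ
      -- The closure of the image of the boundary contains the image of every extension, and it
      -- spans at most `k L` edges because the boundary has at most `k` vertices.
      obtain ⟨X, hYX, hX2, hX⟩ := exists_closure hH hq ((outerBoundary F S R).image φ)
      have hφ : ∀ b ∈ outerBoundary F S R, φ b ∈ X := fun b hb =>
        hYX (Finset.mem_image_of_mem φ hb)
      have hM : ((edgesIn H X).card : ℝ) ≤ (edgesTouching F S R).card * L := by
        refine (le_mul_logb_of_two_pow_le hX2).trans ?_
        gcongr
        exact Finset.card_image_le.trans (card_outerBoundary_le hRS)
      have hcount := card_extensions_into_le hRS hconn (d := ⌊L⌋₊)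
        (fun r hr => Nat.le_floor (hdeg r hr)) ⟨_, hedge⟩ X
        (fun f hf => mem_of_closed (Nat.cast_nonneg n) (by positivity) hq hX hRS hw hf hφ) hφ
      set k := (edgesTouching F S R).card
      calc ((extensions F H S R φ).card : ℝ)
          ≤ ((edgesIn H X).card.choose k : ℝ) * (((2 * k : ℕ) : ℝ) *
            (⌊L⌋₊ : ℝ) ^ (R.card - 1)) := by exact_mod_cast hcount
        _ ≤ (Real.exp 1 * L) ^ k * (2 ^ k * L ^ R.card) := by
            gcongr
            · exact choose_le_mul_exp_pow hM
            · exact_mod_cast two_mul_le_two_pow hk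
            · calc (⌊L⌋₊ : ℝ) ^ (R.card - 1) ≤ L ^ (R.card - 1) := by
                    gcongr; exact Nat.floor_le (by linarith)
                _ ≤ L ^ R.card := pow_le_pow_right₀ hL1 (Nat.sub_le _ _)
        _ = _ := by rw [mul_pow, mul_pow, mul_pow]; ring
  · rw [IsUnsplit] at hconn
    push Not at hconn
    obtain ⟨A, hAR, hA, hno⟩ := hconn
    have hA' : R \ A ⊂ R := Finset.sdiff_ssubset hAR.1 hA
    have hunion : A ∪ R \ A = R := Finset.union_sdiff_of_subset hAR.1
    -- As no edge joins `A` to the rest of `R`, removing that rest does not change the relative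
    -- weights of subsets of `A`, so the induction hypothesis applies to both parts.
    have htouch : ∀ T ⊆ A, edgesTouching F (S \ (R \ A)) T = edgesTouching F S T := by
      intro T hT
      ext e
      induction e with | _ u v =>
      rw [mk_mem_edgesTouching, mk_mem_edgesTouching]
      refine ⟨fun h => ⟨h.1, ⟨(Finset.mem_sdiff.1 h.2.1.1).1, (Finset.mem_sdiff.1 h.2.1.2).1⟩,
        h.2.2⟩, fun h => ⟨h.1, ?_, h.2.2⟩⟩
      have hnot : ∀ a ∈ T, ∀ z, F.Adj a z → z ∉ R \ A := fun a ha z hz hzR =>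
        hno a (hT ha) z hzR hz
      have hself : ∀ a ∈ T, a ∉ R \ A := fun a ha h => (Finset.mem_sdiff.1 h).2 (hT ha)
      rcases h.2.2 with hu | hv
      · exact ⟨Finset.mem_sdiff.2 ⟨h.2.1.1, hself u hu⟩,
          Finset.mem_sdiff.2 ⟨h.2.1.2, hnot u hu v h.1⟩⟩
      · exact ⟨Finset.mem_sdiff.2 ⟨h.2.1.1, hnot v hv u h.1.symm⟩,
          Finset.mem_sdiff.2 ⟨h.2.1.2, hself v hv⟩⟩
    obtain ⟨h1, h1'⟩ := ih A hAR (S \ (R \ A))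
      (fun a ha => Finset.mem_sdiff.2 ⟨hRS (hAR.1 ha), fun h => (Finset.mem_sdiff.1 h).2 ha⟩)
      (fun r hr => hdeg r (hAR.1 hr)) (fun T hT => by
        rw [relWeight, htouch T hT]; exact hw T (hT.trans hAR.1))
    obtain ⟨h2, h2'⟩ := ih (R \ A) hA' S (hA'.1.trans hRS)
      (fun r hr => hdeg r (hA'.1 hr)) (fun T hT => hw T (hT.trans hA'.1))
    have hadd := card_edgesTouching_union (F := F) (S := S) (A := A) (A' := R \ A)
    rw [hunion] at hadd
    have hcardR := Finset.card_sdiff_add_card_eq_card hAR.1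
    refine ⟨by omega, fun φ => ?_⟩
    have := card_extensions_le_mul (H := H) φ (by positivity) (h1' φ) h2'
    rw [hunion] at this
    refine this.trans (le_of_eq ?_)
    rw [hadd, ← hcardR, pow_add, pow_add]
    ring

lemma exists_maximal_packing (hR : R.Nonempty) (E : Finset (U → V)) :
    ∃ P ⊆ E, IsPacking R P ∧ ∀ f ∈ E, ∃ a ∈ R, ∃ g ∈ P, ∃ a' ∈ R, f a = g a' := by
  obtain ⟨P, hP, hmax⟩ := Finset.exists_max_image (E.powerset.filter fun P => IsPacking R P)
    Finset.card ⟨∅, Finset.mem_filter.2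
      ⟨Finset.empty_mem_powerset E, fun f hf => absurd hf (Finset.notMem_empty f)⟩⟩
  simp only [Finset.mem_filter, Finset.mem_powerset] at hP hmax
  refine ⟨P, hP.1, hP.2, fun f hf => ?_⟩
  by_contra! hcon
  have hfP : f ∉ P := fun h => by
    obtain ⟨r, hr⟩ := hR
    exact hcon r hr f h r hr rfl
  have hle := hmax (insert f P) ⟨Finset.insert_subset hf hP.1, ?_⟩
  · rw [Finset.card_insert_of_notMem hfP] at hle
    omega
  · intro g hg g' hg' a ha a' ha' h
    rcases Finset.mem_insert.1 hg with hgf | hgP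
    · rcases Finset.mem_insert.1 hg' with hgf' | hgP'
      · rw [hgf, hgf']
      · exact absurd (hgf ▸ h) (hcon a ha g' hgP' a' ha')
    · rcases Finset.mem_insert.1 hg' with hgf' | hgP'
      · exact absurd (hgf' ▸ h.symm) (hcon a' ha' g hgP a ha)
      · exact hP.2 g hgP g' hgP' a ha a' ha' h

/-- If every extension meets a member of `P`, it suffices to bound the number of extensions with
one more vertex fixed. -/
lemma card_extensions_le_of_packing {P : Finset (U → V)}
    (hP : ∀ f ∈ extensions F H S R φ, ∃ a ∈ R, ∃ g ∈ P, ∃ a' ∈ R, f a = g a') {b : ℝ}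
    (hb : ∀ a ∈ R, ∀ ψ, ((extensions F H S (R.erase a) ψ).card : ℝ) ≤ b) :
    ((extensions F H S R φ).card : ℝ) ≤ (R.card : ℝ) ^ 2 * P.card * b := by
  have hsub : extensions F H S R φ ⊆ ((R ×ˢ P) ×ˢ R).biUnion fun x =>
      extensions F H S (R.erase x.1.1) (Function.update φ x.1.1 (x.1.2 x.2)) := by
    intro f hf
    obtain ⟨a, ha, g, hg, a', ha', h⟩ := hP f hf
    rw [Finset.mem_biUnion]
    refine ⟨((a, g), a'), by simp [ha, hg, ha'], ?_⟩
    rw [mem_extensions] at hf ⊢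
    refine ⟨fun u hu => ?_, hf.2⟩
    by_cases hua : u = a
    · subst hua; simpa using h
    · simpa [hua] using hf.1 u (fun h => hu (Finset.mem_erase.2 ⟨hua, h⟩))
  calc ((extensions F H S R φ).card : ℝ) ≤ _ := Nat.cast_le.2
        ((Finset.card_le_card hsub).trans Finset.card_biUnion_le)
    _ ≤ ∑ _x ∈ (R ×ˢ P) ×ˢ R, b := by
        push_cast
        refine Finset.sum_le_sum fun x hx => hb _ ?_ _
        simp only [Finset.mem_product] at hx
        exact hx.1.1
    _ = _ := by
        rw [Finset.sum_const, Finset.card_product, Finset.card_product, nsmul_eq_mul]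
        push_cast
        ring

end LogBounds

/-! ### Blocks, vertices of high degree, and the bound with two logarithms per edge. -/

section LogBounds

open scoped Classical

variable {U V : Type*} [Fintype U] [Fintype V]
variable {F : SimpleGraph U} {H : SimpleGraph V} {S R : Finset U} {φ f : U → V} {x y : ℝ}
  {n : ℕ} {q : unitInterval}

lemma sq_mul_exp_le {r k : ℕ} (hk : 1 ≤ k) (hr : r ≤ k + 1) :
    (r : ℝ) ^ 2 * Real.exp 1 ≤ (4 * Real.exp 1) ^ k := by
  have h1 : (r : ℝ) ≤ 2 ^ k := by
    have := k.lt_two_pow_self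
    exact_mod_cast (show r ≤ 2 ^ k by omega)
  have h2 : Real.exp 1 ≤ Real.exp 1 ^ k :=
    le_self_pow₀ (Real.one_le_exp (by norm_num)) (by omega)
  calc (r : ℝ) ^ 2 * Real.exp 1 ≤ (2 ^ k) ^ 2 * Real.exp 1 ^ k := by gcongr
    _ = _ := by rw [mul_pow, ← pow_mul, mul_comm k 2, pow_mul]; norm_num

/-- The size of a packing, compared with the expected number `x` of extensions. -/
lemma packing_size_cases {m k t n : ℕ} {x : ℝ} (hm : 1 ≤ m) (hk : 1 ≤ k) (hx : 0 ≤ x)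
    (htk : t ≤ k) (h : (m.factorial : ℝ) * 2 ^ (k * m) ≤ (n : ℝ) ^ t * x ^ m) :
    (m : ℝ) ≤ Real.exp 1 * x ∨ (m : ℝ) ≤ Real.logb 2 n ∧ 1 ≤ t := by
  by_cases hmx : (m : ℝ) ≤ Real.exp 1 * x
  · exact Or.inl hmx
  right
  have he : 0 < Real.exp 1 := Real.exp_pos 1
  -- For `m > e x` one has `x^m ≤ (m/e)^m ≤ m!`. Cancelling `m!` leaves `2^(k m) ≤ n^t`, whence `k m
  -- ≤ t log n ≤ k log n`.
  have hxm : x ^ m ≤ m.factorial := by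
    have h1 := pow_le_exp_pow_mul_factorial m
    have h2 : (Real.exp 1 * x) ^ m ≤ (m : ℝ) ^ m := by
      have := (not_le.1 hmx).le
      gcongr
    rw [mul_pow] at h2
    exact le_of_mul_le_mul_left (h2.trans h1) (by positivity)
  have hfac : (0 : ℝ) < m.factorial := by exact_mod_cast m.factorial_pos
  have h2 : (2 : ℝ) ^ (k * m) ≤ (n : ℝ) ^ t := by
    have : (m.factorial : ℝ) * 2 ^ (k * m) ≤ m.factorial * (n : ℝ) ^ t := by
      rw [mul_comm (m.factorial : ℝ) ((n : ℝ) ^ t)]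
      exact h.trans (by gcongr)
    exact le_of_mul_le_mul_left this hfac
  have ht : 1 ≤ t := by
    by_contra h0
    obtain rfl : t = 0 := by omega
    have := one_lt_pow₀ (a := (2 : ℝ)) (by norm_num) (show k * m ≠ 0 by positivity)
    rw [pow_zero] at h2
    linarith
  refine ⟨?_, ht⟩
  have h3 := le_mul_logb_of_two_pow_le h2
  push_cast at h3
  have hkR : (1 : ℝ) ≤ k := by exact_mod_cast hk
  have htR : (1 : ℝ) ≤ t := by exact_mod_cast ht
  have htk' : (t : ℝ) ≤ k := by exact_mod_cast htk
  have hmR : (1 : ℝ) ≤ m := by exact_mod_cast hm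
  have hL : 0 ≤ Real.logb 2 n := by
    by_contra hneg
    nlinarith
  have : (k : ℝ) * m ≤ k * Real.logb 2 n := h3.trans (by gcongr)
  exact le_of_mul_le_mul_left this (by linarith)

/-- The number of extensions by a block all of whose later stages are unexpected. -/
lemma card_extensions_le_of_block (hH : IsSparse n q H) (c : F.Copy H) (hn : 2 ≤ n)
    (hq : 2 * (q : ℝ) ≤ 1) (hRS : R ⊆ S) (hR : R.Nonempty)
    (hdeg : ∀ r ∈ R, (F.degree r : ℝ) ≤ Real.logb 2 n)
    (hw : ∀ T ⊂ R, relWeight n (2 * q) F S T ≤ 1) (hx : 1 ≤ relWeight n (2 * q) F S R) (φ : U → V) :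
    ((extensions F H S R φ).card : ℝ) ≤
      (8 * Real.exp 1 ^ 2 * Real.logb 2 n ^ 2) ^ (edgesTouching F S R).card *
        relWeight n (2 * q) F S R := by
  set L := Real.logb 2 n with hL
  set k := (edgesTouching F S R).card with hk
  set X := relWeight n (2 * q) F S R with hX
  have hL1 : 1 ≤ L := one_le_logb_two hn
  have hstage : ∀ r ∈ R, (R.erase r).card ≤ (edgesTouching F S (R.erase r)).card ∧ ∀ ψ,
      ((extensions F H S (R.erase r) ψ).card : ℝ) ≤
      (2 * Real.exp 1 * L) ^ k * L ^ (R.card - 1) := by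
    intro r hr
    obtain ⟨h1, h2⟩ := card_extensions_le_of_relWeight_le_one hH c hn hq (R.erase r) S
      ((Finset.erase_subset _ _).trans hRS) (fun r' hr' => hdeg r' (Finset.mem_of_mem_erase hr'))
      (fun T hT => hw T (hT.trans_ssubset (Finset.erase_ssubset hr)))
    refine ⟨h1, fun ψ => (h2 ψ).trans ?_⟩
    rw [Finset.card_erase_of_mem hr]
    have h1e : 1 ≤ 2 * Real.exp 1 * L := by
      have := Real.one_le_exp (show (0 : ℝ) ≤ 1 by norm_num)
      nlinarith
    gcongr ?_ * _
    exact pow_le_pow_right₀ h1e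
      (Finset.card_le_card (edgesTouching_mono (Finset.erase_subset _ _)))
  have hk1 : R.card ≤ k + 1 := by
    obtain ⟨r, hr⟩ := hR
    have h1 := (hstage r hr).1
    rw [Finset.card_erase_of_mem hr] at h1
    have := Finset.card_le_card (edgesTouching_mono (F := F) (S := S) (Finset.erase_subset r R))
    omega
  have hRpos := Finset.card_pos.2 hR
  -- If no edge touches the block, it is a single vertex and the trivial count `|V| ≤ n` is its
  -- relative weight.
  rcases Nat.eq_zero_or_pos k with hk0 | hkpos
  · have hR1 : R.card = 1 := by omega
    have h1 := card_extensions_le_pow (F := F) (H := H) (S := S) (R := R) φ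
    rw [hR1, pow_one] at h1
    have hXn : X = n := by rw [hX, relWeight, ← hk, hk0, hR1]; simp
    rw [hXn, hk0, pow_zero, one_mul]
    exact_mod_cast h1.trans hH.card_le
  obtain ⟨P, hP, hPack, hmax⟩ := exists_maximal_packing hR (extensions F H S R φ)
  have hbound := card_extensions_le_of_packing hmax (fun a ha => (hstage a ha).2)
  rcases P.eq_empty_or_nonempty with rfl | hPne
  · refine hbound.trans ?_
    simp only [Finset.card_empty, Nat.cast_zero, mul_zero, zero_mul]
    positivity
  have hpack := hH.packing_bound hRS hR hP hPne hPack
  have hpack' : (P.card.factorial : ℝ) * 2 ^ (k * P.card) ≤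
      (n : ℝ) ^ (outerBoundary F S R).card * X ^ P.card := by
    calc _ ≤ _ := mul_le_mul_of_nonneg_right hpack (by positivity)
      _ = _ := by
        rw [hX, relWeight, ← hk, mul_pow 2 (q : ℝ), pow_mul, mul_assoc, ← mul_pow]
        ring
  have hfinal : ((extensions F H S R φ).card : ℝ) ≤
      (R.card : ℝ) ^ 2 * (Real.exp 1) * X * ((2 * Real.exp 1 * L) ^ k * L ^ k) := by
    rcases packing_size_cases (Finset.card_pos.2 hPne) hkpos (by linarith)
      (card_outerBoundary_le hRS) hpack' with hm | ⟨hm, hbd⟩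
    · refine hbound.trans ?_
      calc _ ≤ (R.card : ℝ) ^ 2 * (Real.exp 1 * X) * ((2 * Real.exp 1 * L) ^ k * L ^ k) := by
            gcongr
            omega
        _ = _ := by ring
    -- Here the packing may have up to `L` members, which `X` need not absorb. But a boundary vertex
    -- `b` exists, and erasing its neighbour `r` loses an edge, so `|R| - 1 ≤ k - 1` and the
    -- additional `L` fits into `L^k`.
    · obtain ⟨b, hb⟩ := Finset.card_pos.1 hbd
      obtain ⟨⟨hbS, hbR⟩, r, hr, hbr⟩ := mem_outerBoundary.1 hb
      have h1 := card_edgesTouching_erase_lt hRS hbS hbR hr hbr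
      have h2 := (hstage r hr).1
      rw [Finset.card_erase_of_mem hr] at h2
      refine hbound.trans ?_
      have he := Real.one_le_exp (show (0 : ℝ) ≤ 1 by norm_num)
      calc _ ≤ (R.card : ℝ) ^ 2 * L * ((2 * Real.exp 1 * L) ^ k * L ^ (R.card - 1)) := by
            gcongr
        _ = (R.card : ℝ) ^ 2 * ((2 * Real.exp 1 * L) ^ k * L ^ (R.card - 1 + 1)) := by
            rw [pow_succ]; ring
        _ ≤ (R.card : ℝ) ^ 2 * ((2 * Real.exp 1 * L) ^ k * L ^ k) := by
            gcongr
            omega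
        _ ≤ (R.card : ℝ) ^ 2 * ((2 * Real.exp 1 * L) ^ k * L ^ k) * (Real.exp 1 * X) := by
            refine le_mul_of_one_le_right (by positivity) ?_
            nlinarith
        _ = _ := by ring
  refine hfinal.trans ?_
  calc _ ≤ (4 * Real.exp 1) ^ k * X * ((2 * Real.exp 1 * L) ^ k * L ^ k) := by
        gcongr
        exact sq_mul_exp_le hkpos hk1
    _ = _ := by
        rw [show 8 * Real.exp 1 ^ 2 * L ^ 2 = (4 * Real.exp 1) * ((2 * Real.exp 1 * L) * L) by ring,
          mul_pow (4 * Real.exp 1), mul_pow (2 * Real.exp 1 * L)]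
        ring

lemma relWeight_empty : relWeight x y F S ∅ = 1 := by
  simp [relWeight, edgesTouching_empty]

/-- The number of extensions of a copy of `F[S \ R]`, if no intermediate stage is less expected. -/
lemma card_extensions_le_of_weight_le (hH : IsSparse n q H) (c : F.Copy H) (hn : 2 ≤ n)
    (hq0 : 0 < (q : ℝ)) (hq : 2 * (q : ℝ) ≤ 1) (R : Finset U) : R ⊆ S →
    (∀ r ∈ R, (F.degree r : ℝ) ≤ Real.logb 2 n) →
    (∀ T ⊆ R, weight n (2 * q) F (S \ R) ≤ weight n (2 * q) F (S \ T)) →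
    ∀ φ, ((extensions F H S R φ).card : ℝ) ≤
      (8 * Real.exp 1 ^ 2 * Real.logb 2 n ^ 2) ^ (edgesTouching F S R).card *
        relWeight n (2 * q) F S R := by
  have hn0 : (0 : ℝ) < n := by positivity
  have hQ0 : 0 < 2 * (q : ℝ) := by positivity
  induction R using Finset.strongInduction with
  | H R ih =>
  intro hRS hdeg hmin φ
  rcases R.eq_empty_or_nonempty with rfl | hR
  · simp only [edgesTouching_empty, Finset.card_empty, pow_zero, one_mul, relWeight_empty]
    exact_mod_cast card_extensions_empty_le φ
  -- The next block leads to a stage of minimum weight among all later ones. Compared with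
  -- intermediate stages, this gives relative weight at most 1 for the proper subsets of `A`.
  -- Compared with stages beyond, it restores the hypothesis for `R \ A`. The hypothesis on `R`
  -- itself makes the relative weight of `A` at least 1.
  obtain ⟨A, hA, hAmin⟩ := Finset.exists_min_image (R.powerset.filter Finset.Nonempty)
    (fun A => weight n (2 * q) F (S \ (R \ A)))
    ⟨R, Finset.mem_filter.2 ⟨Finset.mem_powerset_self R, hR⟩⟩
  simp only [Finset.mem_filter, Finset.mem_powerset] at hA hAmin
  obtain ⟨hAR, hAne⟩ := hA
  have hunion : A ∪ R \ A = R := Finset.union_sdiff_of_subset hAR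
  have hAS : A ⊆ S \ (R \ A) := fun a ha =>
    Finset.mem_sdiff.2 ⟨hRS (hAR ha), fun h => (Finset.mem_sdiff.1 h).2 ha⟩
  have hsd : ∀ T ⊆ A, (S \ (R \ A)) \ T = S \ (R \ (A \ T)) := by
    intro T hT
    ext u
    simp only [Finset.mem_sdiff]
    have := @hT u
    have := @hAR u
    tauto
  have hrest := ih (R \ A) (Finset.sdiff_ssubset hAR hAne) (Finset.sdiff_subset.trans hRS)
    (fun r hr => hdeg r (Finset.mem_sdiff.1 hr).1) (fun T hT => by
      have hTR : T ⊆ R := hT.trans Finset.sdiff_subset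
      have h1 := hAmin (R \ T) ⟨Finset.sdiff_subset, by
        obtain ⟨a, ha⟩ := hAne
        exact ⟨a, Finset.mem_sdiff.2 ⟨hAR ha, fun h => (Finset.mem_sdiff.1 (hT h)).2 ha⟩⟩⟩
      rwa [Finset.sdiff_sdiff_eq_self hTR] at h1)
  have hblock := card_extensions_le_of_block (H := H) hH c hn hq hAS hAne
    (fun r hr => hdeg r (hAR hr)) (fun T hT => by
      have h1 := hAmin (A \ T) ⟨Finset.sdiff_subset.trans hAR, by
        rw [Finset.sdiff_nonempty]; exact hT.2⟩
      rw [← hsd T hT.1] at h1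
      have h2 := weight_eq_mul (x := n) (y := 2 * q) (F := F) (hT.1.trans hAS)
      have h3 := weight_pos (F := F) (S := (S \ (R \ A)) \ T) hn0 hQ0
      rw [h2] at h1
      by_contra hlt
      nlinarith) (by
      have h1 := hmin (R \ A) Finset.sdiff_subset
      have h2 := weight_eq_mul (x := n) (y := 2 * q) (F := F) hAS
      rw [hsd A (Finset.Subset.refl A), Finset.sdiff_self, Finset.sdiff_empty] at h2
      have h3 := weight_pos (F := F) (S := S \ R) hn0 hQ0
      rw [h2] at h1
      by_contra hlt
      nlinarith) φ
  have := card_extensions_le_mul (H := H) φ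
    (mul_nonneg (by positivity) (relWeight_pos hn0 hQ0).le) hblock hrest
  rw [hunion] at this
  refine this.trans (le_of_eq ?_)
  have h1 := card_edgesTouching_union (F := F) (S := S) (A := A) (A' := R \ A)
  have h2 := relWeight_union (x := n) (y := 2 * q) (F := F) (S := S)
    (Finset.disjoint_sdiff (s := A) (t := R))
  rw [hunion] at h1 h2
  rw [h1, h2, pow_add]
  ring

/-- The degrees sum to `2 e(F)`, so `|B| log n ≤ 2 e(F)`. Hence even placing `B` arbitrarily costs
only a constant factor per edge of `F`. -/
lemma pow_card_high_degree_le (hn : 2 ≤ n) {B : Finset U}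
    (hB : ∀ b ∈ B, Real.logb 2 n ≤ F.degree b) :
    (n : ℝ) ^ B.card ≤ 4 ^ F.edgeFinset.card := by
  have h1 : (B.card : ℝ) * Real.logb 2 n ≤ 2 * F.edgeFinset.card := by
    calc (B.card : ℝ) * Real.logb 2 n ≤ ∑ b ∈ B, (F.degree b : ℝ) := by
          rw [← nsmul_eq_mul]; exact Finset.card_nsmul_le_sum _ _ _ hB
      _ ≤ ∑ b, (F.degree b : ℝ) :=
          Finset.sum_le_sum_of_subset_of_nonneg (Finset.subset_univ _) (fun _ _ _ => by positivity)
      _ = _ := by exact_mod_cast F.sum_degrees_eq_twice_card_edges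
  have hn0 : (0 : ℝ) < n := by positivity
  rw [← Real.rpow_natCast, ← Real.rpow_natCast, show (4 : ℝ) = 2 ^ (2 : ℝ) by norm_num,
    ← Real.rpow_mul (by norm_num)]
  conv_lhs => rw [← Real.rpow_logb (b := 2) (by norm_num) (by norm_num) hn0]
  rw [← Real.rpow_mul (by norm_num)]
  apply Real.rpow_le_rpow_of_exponent_le (by norm_num)
  linarith

/-- The stages are `B ⊆ T ⊆ S`, with `B` the vertices of high degree and `T` of minimum weight
between `B` and `S`. Minimality makes every last part of `T \ B` unexpected and all stages beyond
`T` at least as heavy as `T`, as the two counting lemmas require. -/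
lemma card_extensions_self_le (hH : IsSparse n q H) (c : F.Copy H) (hn : 2 ≤ n)
    (hq0 : 0 < (q : ℝ)) (hq : 2 * (q : ℝ) ≤ 1) (S : Finset U) (φ : U → V) :
    ((extensions F H S S φ).card : ℝ) ≤
      4 ^ F.edgeFinset.card * (8 * Real.exp 1 ^ 2 * Real.logb 2 n ^ 2) ^ (edgesIn F S).card *
        weight n (2 * q) F S := by
  have hn0 : (0 : ℝ) < n := by positivity
  have hQ0 : 0 < 2 * (q : ℝ) := by positivity
  set L := Real.logb 2 n with hL
  have hL1 : 1 ≤ L := one_le_logb_two hn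
  have he := Real.one_le_exp (show (0 : ℝ) ≤ 1 by norm_num)
  set B := S.filter fun u => L < F.degree u with hB
  have hBS : B ⊆ S := Finset.filter_subset _ _
  have hdeg : ∀ r ∈ S, r ∉ B → (F.degree r : ℝ) ≤ L := by
    intro r hr hrB
    by_contra hlt
    exact hrB (Finset.mem_filter.2 ⟨hr, not_le.1 hlt⟩)
  obtain ⟨T, hT, hmin⟩ := Finset.exists_min_image (S.powerset.filter fun T => B ⊆ T)
    (weight n (2 * q) F) ⟨S, by simp [hBS]⟩
  simp only [Finset.mem_filter, Finset.mem_powerset] at hT hmin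
  obtain ⟨hTS, hBT⟩ := hT
  have hbase : ∀ ψ, ((extensions F H B B ψ).card : ℝ) ≤ 4 ^ F.edgeFinset.card := by
    intro ψ
    refine le_trans ?_ (pow_card_high_degree_le hn (B := B)
      fun b hb => (Finset.mem_filter.1 hb).2.le)
    calc ((extensions F H B B ψ).card : ℝ) ≤ (Fintype.card V : ℝ) ^ B.card := by
          exact_mod_cast card_extensions_le_pow ψ
      _ ≤ _ := by
          have := hH.card_le
          gcongr
  obtain ⟨h1, h1'⟩ := card_extensions_le_of_relWeight_le_one hH c hn hq (T \ B) T
    Finset.sdiff_subset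
    (fun r hr => hdeg r (hTS (Finset.mem_sdiff.1 hr).1) (Finset.mem_sdiff.1 hr).2)
    (fun A hA => by
      have hAT : A ⊆ T := hA.trans Finset.sdiff_subset
      have h1 := hmin (T \ A) ⟨Finset.sdiff_subset.trans hTS, fun b hb =>
        Finset.mem_sdiff.2 ⟨hBT hb, fun h => (Finset.mem_sdiff.1 (hA h)).2 hb⟩⟩
      rw [weight_eq_mul hAT] at h1
      have h3 := weight_pos (F := F) (S := T \ A) hn0 hQ0
      by_contra hlt
      nlinarith)
  have h2 := card_extensions_le_of_weight_le (S := S) hH c hn hq0 hq (S \ T) Finset.sdiff_subset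
    (fun r hr => hdeg r (Finset.mem_sdiff.1 hr).1 fun h => (Finset.mem_sdiff.1 hr).2 (hBT h))
    (fun A hA => by
      rw [Finset.sdiff_sdiff_eq_self hTS]
      exact hmin _ ⟨Finset.sdiff_subset, fun b hb =>
        Finset.mem_sdiff.2 ⟨hBS hb, fun h => (Finset.mem_sdiff.1 (hA h)).2 (hBT hb)⟩⟩)
  have hmid : ∀ ψ, ((extensions F H T (T \ B) ψ).card : ℝ) ≤
      (8 * Real.exp 1 ^ 2 * L ^ 2) ^ (edgesTouching F T (T \ B)).card := by
    intro ψ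
    refine (h1' ψ).trans ?_
    calc _ ≤ (2 * Real.exp 1 * L) ^ (edgesTouching F T (T \ B)).card *
          L ^ (edgesTouching F T (T \ B)).card := by
            gcongr
      _ = (2 * Real.exp 1 * L * L) ^ (edgesTouching F T (T \ B)).card := by rw [← mul_pow]
      _ ≤ _ := by
          refine pow_le_pow_left₀ (by positivity) ?_ _
          have : Real.exp 1 ≤ 4 * Real.exp 1 ^ 2 := by nlinarith
          calc 2 * Real.exp 1 * L * L = 2 * Real.exp 1 * L ^ 2 := by ring
            _ ≤ 2 * (4 * Real.exp 1 ^ 2) * L ^ 2 := by gcongr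
            _ = _ := by ring
  have hchain1 := card_extensions_le_mul (F := F) (H := H) (S := T) (A := B) (A' := T \ B) φ
    (a := 4 ^ F.edgeFinset.card) (by positivity) (by rw [Finset.sdiff_sdiff_eq_self hBT]; exact hbase φ) hmid
  rw [Finset.union_sdiff_of_subset hBT] at hchain1
  have hchain2 := card_extensions_le_mul (F := F) (H := H) (S := S) (A := T) (A' := S \ T) φ
    (a := 4 ^ F.edgeFinset.card *
      (8 * Real.exp 1 ^ 2 * L ^ 2) ^ (edgesTouching F T (T \ B)).card)
    (mul_nonneg (by positivity) (relWeight_pos hn0 hQ0).le)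
    (by rw [Finset.sdiff_sdiff_eq_self hTS]; exact hchain1) h2
  rw [Finset.union_sdiff_of_subset hTS] at hchain2
  -- The count up to `T` contains no weight factor, so `weight T ≥ 1` is what allows the relative
  -- weight of `S \ T` to be replaced by the weight of `S`.
  have hwT : 1 ≤ weight n (2 * q) F T :=
    le_trans (one_le_pow₀ (by norm_num)) (hH.two_pow_le_weight c T)
  have hwS : relWeight n (2 * q) F S (S \ T) ≤ weight n (2 * q) F S := by
    have := weight_eq_mul (x := n) (y := 2 * q) (F := F) (Finset.sdiff_subset (s := S) (t := T))
    rw [Finset.sdiff_sdiff_eq_self hTS] at this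
    rw [this]
    exact le_mul_of_one_le_left (relWeight_pos hn0 hQ0).le hwT
  have hedges : (edgesTouching F T (T \ B)).card + (edgesTouching F S (S \ T)).card ≤
      (edgesIn F S).card := by
    have e1 := card_edgesIn_eq F S (S \ T)
    have e2 := card_edgesIn_eq F T (T \ B)
    rw [Finset.sdiff_sdiff_eq_self hTS] at e1
    omega
  refine hchain2.trans ?_
  have hc1 : 1 ≤ 8 * Real.exp 1 ^ 2 * L ^ 2 := by
    have := one_le_pow₀ he (n := 2)
    have := one_le_pow₀ hL1 (n := 2)
    nlinarith
  calc _ = 4 ^ F.edgeFinset.card * (8 * Real.exp 1 ^ 2 * L ^ 2) ^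
        ((edgesTouching F T (T \ B)).card + (edgesTouching F S (S \ T)).card) *
        relWeight n (2 * q) F S (S \ T) := by rw [pow_add]; ring
    _ ≤ _ := by
        have := (relWeight_pos (F := F) (S := S) (R := S \ T) hn0 hQ0).le
        gcongr

end LogBounds

/-! ### From extensions to copies, and the bound with the squared logarithm. -/

section Assembly

open scoped Classical

variable {U V : Type*} [Fintype U] [Fintype V]
variable {F : SimpleGraph U} {H : SimpleGraph V} {S R : Finset U} {φ f : U → V}
  {n : ℕ} {p q : unitInterval}

lemma pow_le_exp_pow_mul_descFactorial {n s : ℕ} (h : s ≤ n) :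
    (n : ℝ) ^ s ≤ Real.exp 1 ^ s * n.descFactorial s := by
  have h1 : (n : ℝ) ^ s * s.factorial ≤ n.descFactorial s * (s : ℝ) ^ s := by
    rw [← Nat.descFactorial_self, Nat.descFactorial_eq_prod_range, Nat.descFactorial_eq_prod_range]
    push_cast
    rw [← Finset.card_range s, ← Finset.prod_const, ← Finset.prod_const, Finset.card_range,
      ← Finset.prod_mul_distrib, ← Finset.prod_mul_distrib]
    refine Finset.prod_le_prod (fun i _ => by positivity) fun i hi => ?_
    have his : i < s := Finset.mem_range.1 hi
    rw [Nat.cast_sub his.le, Nat.cast_sub (his.le.trans h)]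
    have : (s : ℝ) ≤ n := by exact_mod_cast h
    have : (0 : ℝ) ≤ i := Nat.cast_nonneg i
    nlinarith
  have h2 := pow_le_exp_pow_mul_factorial s
  have hfac : (0 : ℝ) < s.factorial := by exact_mod_cast s.factorial_pos
  refine le_of_mul_le_mul_right (h1.trans ?_) hfac
  calc (n.descFactorial s : ℝ) * (s : ℝ) ^ s
      ≤ n.descFactorial s * (Real.exp 1 ^ s * s.factorial) := by gcongr
    _ = _ := by ring

/-- The vertices of positive degree. -/
noncomputable def nonisolated (F : SimpleGraph U) : Finset U :=
  Finset.univ.filter fun u => ∃ v, F.Adj u v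

lemma mem_nonisolated {u : U} : u ∈ nonisolated F ↔ ∃ v, F.Adj u v := by
  simp [nonisolated]

lemma edgesIn_nonisolated : edgesIn F (nonisolated F) = F.edgeFinset := by
  ext e
  induction e with | _ u v =>
  rw [mk_mem_edgesIn, SimpleGraph.mem_edgeFinset, SimpleGraph.mem_edgeSet]
  exact ⟨fun h => h.1, fun h => ⟨h, mem_nonisolated.2 ⟨v, h⟩, mem_nonisolated.2 ⟨u, h.symm⟩⟩⟩

lemma card_nonisolated_le : (nonisolated F).card ≤ 2 * F.edgeFinset.card := by
  refine le_trans (Finset.card_le_card fun u hu => ?_) (card_vertices_le F.edgeFinset)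
  obtain ⟨v, hv⟩ := mem_nonisolated.1 hu
  exact Finset.mem_filter.2 ⟨Finset.mem_univ _, s(u, v), by simpa using hv, by simp⟩

lemma labelledCopyCount_eq_card_extensions (φ : U → V) :
    H.labelledCopyCount F = (extensions F H Finset.univ Finset.univ φ).card := by
  rw [labelledCopyCount_eq_natCard, Nat.card_eq_fintype_card, Fintype.card_subtype, extensions]
  congr 1
  ext f
  simp [Set.injOn_univ]

lemma card_extensions_compl_le (S : Finset U) (ψ : U → V) :
    (extensions F H Finset.univ Sᶜ ψ).card ≤
      (Fintype.card V - S.card).descFactorial (Fintype.card U - S.card) := by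
  rcases (extensions F H Finset.univ Sᶜ ψ).eq_empty_or_nonempty with h | ⟨f₀, hf₀⟩
  · simp [h]
  rw [mem_extensions] at hf₀
  have hagree : ∀ u ∈ S, f₀ u = ψ u := fun u hu => hf₀.1 u (by simpa using hu)
  have hψ : (S.image ψ).card = S.card := by
    refine Finset.card_image_of_injOn fun u hu v hv h => ?_
    rw [← hagree u hu, ← hagree v hv] at h
    exact hf₀.2.1 (by simp) (by simp) h
  have hcard : (Fintype.card V - S.card).descFactorial (Fintype.card U - S.card) =
      Fintype.card (↥(Sᶜ : Finset U) ↪ ↥((S.image ψ)ᶜ : Finset V)) := by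
    rw [Fintype.card_embedding_eq, Fintype.card_coe, Fintype.card_coe, Finset.card_compl,
      Finset.card_compl, hψ]
  rw [hcard, ← Fintype.card_coe]
  refine Fintype.card_le_of_injective (fun f => ⟨fun u => ⟨f.1 u, ?_⟩, ?_⟩) ?_
  · have hf := mem_extensions.1 f.2
    rw [Finset.mem_compl, Finset.mem_image]
    rintro ⟨v, hv, h⟩
    rw [← hf.1 v (by simpa using hv)] at h
    have := hf.2.1 (by simp) (by simp) h
    exact absurd hv (by rw [this]; exact Finset.mem_compl.1 u.2)
  · intro u v h
    exact Subtype.ext ((mem_extensions.1 f.2).2.1 (by simp) (by simp) (congrArg Subtype.val h))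
  · intro f g h
    apply Subtype.ext
    ext u
    by_cases hu : u ∈ S
    · rw [(mem_extensions.1 f.2).1 u (by simpa using hu),
        (mem_extensions.1 g.2).1 u (by simpa using hu)]
    · have := DFunLike.congr_fun h ⟨u, by simpa using hu⟩
      exact congrArg Subtype.val this

/-- Isolated vertices of `F` must be counted exactly, by a falling factorial, since no edge could
pay for a loss. Replacing `n^s` by `(n)_s` on the `s` other vertices costs `e^s`, and `s ≤ 2 e(F)`
turns this into `e^2` per edge. -/
lemma labelledCopyCount_le (hV : Fintype.card V ≤ n) {r : ℝ} (hr : 0 ≤ r)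
    (h : ∀ φ : U → V, ((extensions F H (nonisolated F) (nonisolated F) φ).card : ℝ) ≤
      (n : ℝ) ^ (nonisolated F).card * r ^ F.edgeFinset.card) :
    (H.labelledCopyCount F : ℝ) ≤
      n.descFactorial (Fintype.card U) * (Real.exp 1 ^ 2 * r) ^ F.edgeFinset.card := by
  rcases Nat.eq_zero_or_pos (H.labelledCopyCount F) with h0 | hpos
  · rw [h0, Nat.cast_zero]
    positivity
  obtain ⟨φ⟩ := SimpleGraph.labelledCopyCount_pos.1 hpos
  have hUV : Fintype.card U ≤ Fintype.card V := Fintype.card_le_of_injective φ φ.injective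
  set S := nonisolated F with hS
  have hSU : S.card ≤ Fintype.card U := Finset.card_le_univ S
  rw [labelledCopyCount_eq_card_extensions φ]
  have hunion : S ∪ Sᶜ = Finset.univ := Finset.union_compl S
  have hchain := card_extensions_le_mul (F := F) (H := H) (S := Finset.univ) (A := S) (A' := Sᶜ) φ
    (a := (n : ℝ) ^ S.card * r ^ F.edgeFinset.card)
    (b := ((n - S.card).descFactorial (Fintype.card U - S.card) : ℝ)) (by positivity)
    (by rw [← Finset.compl_eq_univ_sdiff, compl_compl]; exact h φ)
    (fun ψ => by
      refine Nat.cast_le.2 ((card_extensions_compl_le S ψ).trans ?_)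
      exact Nat.descFactorial_le _ (by omega))
  rw [hunion] at hchain
  refine hchain.trans ?_
  have hmul := Nat.descFactorial_mul_descFactorial (n := n) hSU
  have he := Real.one_le_exp (show (0 : ℝ) ≤ 1 by norm_num)
  calc _ ≤ (Real.exp 1 ^ S.card * n.descFactorial S.card) * r ^ F.edgeFinset.card *
        (n - S.card).descFactorial (Fintype.card U - S.card) := by
        gcongr
        exact pow_le_exp_pow_mul_descFactorial (by omega)
    _ ≤ (Real.exp 1 ^ (2 * F.edgeFinset.card) * n.descFactorial S.card) * r ^ F.edgeFinset.card *
        (n - S.card).descFactorial (Fintype.card U - S.card) := by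
        gcongr
        exact card_nonisolated_le
    _ = _ := by
        rw [← hmul, mul_pow, pow_mul]
        push_cast
        ring

lemma copyCount_bounds_of_extensions (hH : IsSparse n q H) (c : F.Copy H) {r : ℝ} (hr : 0 ≤ r)
    (hp : F.edgeSet.Nonempty → Real.exp 1 ^ 2 * r < p)
    (h : F.edgeSet.Nonempty → ∀ φ : U → V,
      ((extensions F H (nonisolated F) (nonisolated F) φ).card : ℝ) ≤
      (n : ℝ) ^ (nonisolated F).card * r ^ F.edgeFinset.card) :
    (H.copyCount F : ℝ) ≤ expectedCopies n p F ∧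
      (F.edgeSet.Nonempty → (H.copyCount F : ℝ) < expectedCopies n p F) := by
  have hedge : Nat.card F.edgeSet = F.edgeFinset.card := by
    rw [Nat.card_eq_fintype_card, SimpleGraph.edgeFinset_card]
  by_cases hE : F.edgeSet.Nonempty
  · have hE' : F.edgeFinset.card ≠ 0 := by
      rw [Finset.card_ne_zero]
      exact SimpleGraph.edgeFinset_nonempty.2 (SimpleGraph.edgeSet_nonempty.1 hE)
    have hlab := labelledCopyCount_le hH.card_le hr (h hE)
    have hdesc : (0 : ℝ) < n.descFactorial (Fintype.card U) := by
      have h1 : Fintype.card U ≤ n :=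
        (Fintype.card_le_of_injective c c.injective).trans hH.card_le
      exact_mod_cast Nat.descFactorial_pos.2 h1
    have hlt : (H.copyCount F : ℝ) < expectedCopies n p F := by
      apply copyCount_lt_expectedCopies
      rw [hedge]
      refine hlab.trans_lt ?_
      have := pow_lt_pow_left₀ (hp hE) (by positivity) hE'
      gcongr
    exact ⟨hlt.le, fun _ => hlt⟩
  · refine ⟨?_, fun h => absurd h hE⟩
    have hbot : F = ⊥ := by
      by_contra hF
      exact hE (SimpleGraph.edgeSet_nonempty.2 hF)
    have hE0 : F.edgeFinset.card = 0 := by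
      rw [Finset.card_eq_zero, SimpleGraph.edgeFinset_eq_empty]
      exact hbot
    have hS : nonisolated F = ∅ := by
      rw [← Finset.card_eq_zero]
      have := card_nonisolated_le (F := F)
      omega
    apply copyCount_le_expectedCopies
    have hlab := labelledCopyCount_le (F := F) (H := H) hH.card_le hr (fun φ => by
      rw [hS, hE0, Finset.card_empty, pow_zero, pow_zero, mul_one]
      exact_mod_cast card_extensions_empty_le φ)
    rw [hedge]
    rw [hE0, pow_zero] at hlab ⊢
    exact hlab

lemma IsSparse.pos_of_edge (hH : IsSparse n q H) (c : F.Copy H) (hE : F.edgeSet.Nonempty) :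
    0 < (q : ℝ) := by
  have hE' : (edgesIn F (nonisolated F)).card ≠ 0 := by
    rw [edgesIn_nonisolated, Finset.card_ne_zero]
    exact SimpleGraph.edgeFinset_nonempty.2 (SimpleGraph.edgeSet_nonempty.1 hE)
  have h1 := hH.one_le_weight c (nonisolated F)
  rcases q.2.1.eq_or_lt with h0 | h0
  · rw [weight, ← h0, zero_pow hE'] at h1
    norm_num at h1
  · exact h0

lemma IsSparse.two_le_of_edge (hH : IsSparse n q H) (c : F.Copy H) (hE : F.edgeSet.Nonempty) :
    2 ≤ n := by
  obtain ⟨e, he⟩ := hE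
  induction e with | _ u v =>
  have huv : c u ≠ c v := fun h => F.ne_of_adj he (c.injective h)
  have : Nontrivial V := ⟨⟨_, _, huv⟩⟩
  have := Fintype.one_lt_card (α := V)
  have := hH.card_le
  omega

/-- The constant may be taken to be `128 e⁴`. -/
lemma copyCount_bounds_log_sq (hH : IsSparse n q H) (c : F.Copy H)
    (hp : (p : ℝ) = 128 * Real.exp 1 ^ 4 * (q : ℝ) * Real.logb 2 n ^ 2) :
    (H.copyCount F : ℝ) ≤ expectedCopies n p F ∧
      (F.edgeSet.Nonempty → (H.copyCount F : ℝ) < expectedCopies n p F) := by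
  have he := Real.one_le_exp (show (0 : ℝ) ≤ 1 by norm_num)
  have he4 := one_le_pow₀ he (n := 4)
  have hq0 := q.2.1
  -- Per edge: 4 from the vertices of high degree, `8 e^2 L^2` from the stages and `2q` from the
  -- weight. The factor `e^2` gives `64 e^4`, and doubling it makes the inequality strict.
  refine copyCount_bounds_of_extensions hH c (r := 64 * Real.exp 1 ^ 2 * Real.logb 2 n ^ 2 * q)
    (by positivity) (fun hE => ?_) (fun hE φ => ?_)
  · have hq := hH.pos_of_edge c hE
    have hL := one_le_logb_two (hH.two_le_of_edge c hE)
    rw [hp]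
    have : 0 < Real.exp 1 ^ 4 * (q : ℝ) * Real.logb 2 n ^ 2 := by positivity
    linarith
  · have hq := hH.pos_of_edge c hE
    have hn := hH.two_le_of_edge c hE
    have hL := one_le_pow₀ (one_le_logb_two hn) (n := 2)
    -- The bound is forced by `p ≤ 1`.
    have hq2 : 2 * (q : ℝ) ≤ 1 := by
      have hp1 := p.2.2
      rw [hp] at hp1
      have h1 : (q : ℝ) ≤ Real.exp 1 ^ 4 * (q : ℝ) := le_mul_of_one_le_left hq0 he4
      have h2 : Real.exp 1 ^ 4 * (q : ℝ) ≤ Real.exp 1 ^ 4 * (q : ℝ) * Real.logb 2 n ^ 2 :=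
        le_mul_of_one_le_right (by positivity) hL
      linarith
    refine (card_extensions_self_le hH c hn hq hq2 (nonisolated F) φ).trans (le_of_eq ?_)
    rw [weight, edgesIn_nonisolated, mul_left_comm, ← mul_pow, ← mul_pow]
    ring

end Assembly

/-! ### Copies of connected graphs when all components are trees. -/

section Trees

open scoped Classical

variable {V A W : Type*} [Fintype V] [Fintype A] [Fintype W]
variable {H : SimpleGraph V} {n : ℕ} {q : unitInterval}

/-- The injective maps that identify `τ` with a connected component of `H`. -/
noncomputable def componentMaps (H : SimpleGraph V) (τ : SimpleGraph W) : Finset (W → V) :=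
  Finset.univ.filter fun ψ => Function.Injective ψ ∧
    (∃ C : H.ConnectedComponent, Set.range ψ = C.supp) ∧ H.comap ψ = τ

lemma mem_componentMaps {τ : SimpleGraph W} {ψ : W → V} :
    ψ ∈ componentMaps H τ ↔ Function.Injective ψ ∧
      (∃ C : H.ConnectedComponent, Set.range ψ = C.supp) ∧ H.comap ψ = τ := by
  simp [componentMaps]

lemma connected_of_mem_componentMaps {τ : SimpleGraph W} {ψ : W → V}
    (h : ψ ∈ componentMaps H τ) : τ.Connected := by
  obtain ⟨hinj, ⟨C, hC⟩, rfl⟩ := mem_componentMaps.1 h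
  let e := (SimpleGraph.Embedding.comap ⟨ψ, hinj⟩ H).isoInduceRange
  have h2 : (H.induce (Set.range ψ)).Connected := by
    rw [hC]
    exact C.connected_toSimpleGraph
  exact e.connected_iff.2 h2

/-- Components are disjoint, so the `m` components isomorphic to `τ` are petals with empty core, and
`m! |Aut τ|^m ≤ (n^w q^e)^m`. The maps number at most `m |Aut τ|`, and `m^m ≤ e^m m!` concludes.
Here the full automorphism count of the petals is needed. -/
lemma card_componentMaps_le (hH : IsSparse n q H) (τ : SimpleGraph W) :
    ((componentMaps H τ).card : ℝ) ≤
      Real.exp 1 * ((n : ℝ) ^ Fintype.card W * (q : ℝ) ^ Nat.card τ.edgeSet) := by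
  rcases (componentMaps H τ).eq_empty_or_nonempty with h0 | ⟨ψ₁, hψ₁⟩
  · have := q.2.1
    rw [h0, Finset.card_empty, Nat.cast_zero]
    positivity
  have : Nonempty W := (connected_of_mem_componentMaps hψ₁).nonempty
  let T : SimpleGraph (Empty ⊕ W) := τ.comap (Equiv.emptySum Empty W)
  have hTE : Nat.card T.edgeSet = Nat.card τ.edgeSet :=
    Nat.card_congr (SimpleGraph.Iso.comap (Equiv.emptySum Empty W) τ).mapEdgeSet
  let 𝒞 := (componentMaps H τ).image Set.range
  have hrep : ∀ C : 𝒞, ∃ ψ ∈ componentMaps H τ, Set.range ψ = C.1 := fun C =>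
    Finset.mem_image.1 C.2
  choose rep hrep hrange using hrep
  have hcount : (componentMaps H τ).card ≤ Nat.card (RelAut T) * 𝒞.card := by
    refine Finset.card_le_mul_card_image (f := Set.range) _ _ fun C hC => ?_
    have hex : ∀ ψ : {ψ // ψ ∈ (componentMaps H τ).filter fun ψ => Set.range ψ = C},
        ∃ g : RelAut T, ∀ w, rep ⟨C, hC⟩ (g.1 w) = ψ.1 w := by
      rintro ⟨ψ, hψ⟩
      obtain ⟨hψ, hψC⟩ := Finset.mem_filter.1 hψ
      obtain ⟨hinj, -, hcomap⟩ := mem_componentMaps.1 hψ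
      obtain ⟨hinj', -, hcomap'⟩ := mem_componentMaps.1 (hrep ⟨C, hC⟩)
      let g : W ≃ W := (Equiv.ofInjective ψ hinj).trans
        ((Equiv.setCongr (hψC.trans (hrange ⟨C, hC⟩).symm)).trans
          (Equiv.ofInjective _ hinj').symm)
      have hg : ∀ w, rep ⟨C, hC⟩ (g w) = ψ w := fun w =>
        Equiv.apply_ofInjective_symm hinj' _
      have hadj : ∀ x y, τ.Adj (g x) (g y) ↔ τ.Adj x y := by
        intro x y
        conv_lhs => rw [← hcomap']
        conv_rhs => rw [← hcomap]
        rw [SimpleGraph.comap_adj, SimpleGraph.comap_adj, hg, hg]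
      refine ⟨⟨g, ?_⟩, hg⟩
      rintro (x | x) (y | y)
      · exact x.elim
      · exact x.elim
      · exact y.elim
      · exact hadj x y
    choose g hg using hex
    rw [← Fintype.card_coe, ← Nat.card_eq_fintype_card]
    refine Nat.card_le_card_of_injective g fun ψ ψ' h => ?_
    apply Subtype.ext
    ext w
    rw [← hg, ← hg, h]
  have hbound := hH.petal_bound (ι := 𝒞) T (fun b => b.elim) (fun b => b.elim) rep
    (fun C => by
      rintro (x | x) (y | y) h
      · exact x.elim
      · exact x.elim
      · exact y.elim
      · exact congrArg _ ((mem_componentMaps.1 (hrep C)).1 h))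
    (fun b => b.elim)
    (fun C => by
      rintro (x | x) (y | y) h
      · exact x.elim
      · exact x.elim
      · exact y.elim
      · have h' : τ.Adj x y := h
        rwa [← (mem_componentMaps.1 (hrep C)).2.2] at h')
    (fun C C' a a' h => by
      obtain ⟨-, ⟨D, hD⟩, -⟩ := mem_componentMaps.1 (hrep C)
      obtain ⟨-, ⟨D', hD'⟩, -⟩ := mem_componentMaps.1 (hrep C')
      have h1 : rep C a ∈ D.supp := hD ▸ Set.mem_range_self a
      have h2 : rep C' a' ∈ D'.supp := hD' ▸ Set.mem_range_self a'
      rw [SimpleGraph.ConnectedComponent.mem_supp_iff] at h1 h2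
      apply Subtype.ext
      rw [← hrange C, ← hrange C', hD, hD', ← h1, ← h2, h])
  rw [Fintype.card_eq_zero (α := Empty), pow_zero, one_mul, hTE, Fintype.card_coe] at hbound
  have hm : 𝒞.card ≠ 0 := Finset.card_ne_zero.2 ⟨_, Finset.mem_image_of_mem _ hψ₁⟩
  have hq0 := q.2.1
  have hpow : ((Nat.card (RelAut T) * 𝒞.card : ℕ) : ℝ) ≤
      Real.exp 1 * ((n : ℝ) ^ Fintype.card W * (q : ℝ) ^ Nat.card τ.edgeSet) := by
    rw [← pow_le_pow_iff_left₀ (by positivity) (by positivity) hm]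
    push_cast
    calc ((Nat.card (RelAut T) : ℝ) * 𝒞.card) ^ 𝒞.card
        = (Nat.card (RelAut T) : ℝ) ^ 𝒞.card * (𝒞.card : ℝ) ^ 𝒞.card := mul_pow _ _ _
      _ ≤ (Nat.card (RelAut T) : ℝ) ^ 𝒞.card *
          (Real.exp 1 ^ 𝒞.card * (𝒞.card).factorial) := by
          gcongr
          exact pow_le_exp_pow_mul_factorial _
      _ = Real.exp 1 ^ 𝒞.card *
          (((𝒞.card).factorial : ℝ) * (Nat.card (RelAut T) : ℝ) ^ 𝒞.card) := by ring
      _ ≤ _ := by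
          rw [mul_pow]
          gcongr
  exact (Nat.cast_le.2 hcount).trans hpow

/-- There are few trees on a given set of vertices that contain a given connected graph. -/
lemma card_trees_le (T : SimpleGraph A) (hT : T.Connected) (k : ℕ) :
    (Finset.univ.filter fun τ : SimpleGraph (A ⊕ Fin k) => τ.Connected ∧
      Nat.card τ.edgeSet + 1 ≤ Fintype.card A + k ∧
      ∀ a b, T.Adj a b → τ.Adj (Sum.inl a) (Sum.inl b)).card ≤ (Fintype.card A + k) ^ k := by
  obtain ⟨a₀⟩ := hT.nonempty
  have : Nonempty A := ⟨a₀⟩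
  -- Each new vertex gets a parent, a neighbour closer to the root `a₀`. The edges of `T` and the
  -- `k` parent edges will be all edges of `τ`, so the parent function determines `τ`.
  have hpar : ∀ (τ : SimpleGraph (A ⊕ Fin k)) (i : Fin k), τ.Connected → ∃ w,
      τ.Adj (Sum.inr i) w ∧ τ.dist w (Sum.inl a₀) < τ.dist (Sum.inr i) (Sum.inl a₀) := by
    intro τ i hτ
    obtain ⟨p, hp⟩ := hτ.exists_walk_length_eq_dist (Sum.inr i) (Sum.inl a₀)
    cases p with
    | cons h p' =>
      refine ⟨_, h, ?_⟩
      rw [← hp, SimpleGraph.Walk.length_cons]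
      exact Nat.lt_succ_of_le (SimpleGraph.dist_le p')
  choose! par hpar1 hpar2 using hpar
  let D : (Fin k → A ⊕ Fin k) → Finset (Sym2 (A ⊕ Fin k)) := fun g =>
    T.edgeFinset.image (Sym2.map Sum.inl) ∪ Finset.univ.image fun i => s(Sum.inr i, g i)
  have hD : ∀ τ : SimpleGraph (A ⊕ Fin k), τ.Connected →
      Nat.card τ.edgeSet + 1 ≤ Fintype.card A + k →
      (∀ a b, T.Adj a b → τ.Adj (Sum.inl a) (Sum.inl b)) → D (par τ) = τ.edgeFinset := by
    intro τ hτ hcard hsub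
    apply Finset.eq_of_subset_of_card_le
    · refine Finset.union_subset ?_ ?_
      · intro e' he'
        obtain ⟨e, he, rfl⟩ := Finset.mem_image.1 he'
        induction e with | _ u v =>
        rw [SimpleGraph.mem_edgeFinset, SimpleGraph.mem_edgeSet] at he
        rw [Sym2.map_mk, SimpleGraph.mem_edgeFinset, SimpleGraph.mem_edgeSet]
        exact hsub u v he
      · intro e he
        obtain ⟨i, -, rfl⟩ := Finset.mem_image.1 he
        rw [SimpleGraph.mem_edgeFinset, SimpleGraph.mem_edgeSet]
        exact hpar1 τ i hτ
    · rw [Finset.card_union_of_disjoint, Finset.card_image_of_injective _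
        (Sym2.map.injective Sum.inl_injective), Finset.card_image_of_injective]
      · have h1 := hT.card_vert_le_card_edgeSet_add_one
        rw [Nat.card_eq_fintype_card, Nat.card_eq_fintype_card,
          ← SimpleGraph.edgeFinset_card] at h1
        rw [Nat.card_eq_fintype_card, ← SimpleGraph.edgeFinset_card] at hcard
        simp only [Finset.card_univ, Fintype.card_fin]
        omega
      -- Two new vertices cannot be each other's parent, as distances to the root decrease strictly.
      · intro i j hij
        rcases Sym2.eq_iff.1 hij with h | h
        · exact Sum.inr_injective h.1
        · have h1 := hpar2 τ i hτ
          have h2 := hpar2 τ j hτ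
          rw [h.2] at h1
          rw [← h.1] at h2
          omega
      · rw [Finset.disjoint_left]
        intro e he he'
        obtain ⟨i, -, rfl⟩ := Finset.mem_image.1 he'
        obtain ⟨e, -, h⟩ := Finset.mem_image.1 he
        have : (Sum.inr i : A ⊕ Fin k) ∈ Sym2.map Sum.inl e := by rw [h]; simp
        obtain ⟨x, -, hx⟩ := Sym2.mem_map.1 this
        simp at hx
  have hbound : (Finset.univ.filter fun τ : SimpleGraph (A ⊕ Fin k) => τ.Connected ∧
      Nat.card τ.edgeSet + 1 ≤ Fintype.card A + k ∧
      ∀ a b, T.Adj a b → τ.Adj (Sum.inl a) (Sum.inl b)).card ≤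
      (Finset.univ : Finset (Fin k → A ⊕ Fin k)).card := by
    refine Finset.card_le_card_of_injOn par (fun _ _ => Finset.mem_univ _) ?_
    intro τ hτ σ hσ h
    simp only [Finset.coe_filter, Finset.mem_univ, true_and, Set.mem_ofPred_eq] at hτ hσ
    have h1 := hD τ hτ.1 hτ.2.1 hτ.2.2
    rw [h, hD σ hσ.1 hσ.2.1 hσ.2.2] at h1
    exact (SimpleGraph.edgeFinset_inj.1 h1).symm
  refine hbound.trans (le_of_eq ?_)
  simp

/-- The injective homomorphisms from `T` to `H` whose image lies in a component with `s` vertices. -/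
noncomputable def copiesInComponents (H : SimpleGraph V) (T : SimpleGraph A) (a₀ : A) (s : ℕ) :
    Finset (A → V) :=
  Finset.univ.filter fun f => (Function.Injective f ∧ ∀ a b, T.Adj a b → H.Adj (f a) (f b)) ∧
    (H.connectedComponentMk (f a₀)).supp.toFinset.card = s

/-- The injective maps onto components of `H` that extend a homomorphism from `T`. -/
noncomputable def spanningMaps (H : SimpleGraph V) (T : SimpleGraph A) (k : ℕ) :
    Finset (A ⊕ Fin k → V) :=
  Finset.univ.filter fun ψ => Function.Injective ψ ∧
    (∃ C : H.ConnectedComponent, Set.range ψ = C.supp) ∧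
    ∀ a b, T.Adj a b → H.Adj (ψ (Sum.inl a)) (ψ (Sum.inl b))

lemma mem_supp_of_hom {T : SimpleGraph A} (hT : T.Connected) {f : A → V}
    (hf : ∀ a b, T.Adj a b → H.Adj (f a) (f b)) (a₀ a : A) :
    f a ∈ (H.connectedComponentMk (f a₀)).supp := by
  rw [SimpleGraph.ConnectedComponent.mem_supp_iff, SimpleGraph.ConnectedComponent.eq]
  exact (hT.preconnected a a₀).map (⟨f, fun {a b} h => hf a b h⟩ : T →g H)

/-- A copy of `T` in a component with `k` further vertices extends to a bijection onto that
component in `k!` ways, by ordering these vertices. -/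
lemma factorial_mul_card_copiesInComponents_le {T : SimpleGraph A} (hT : T.Connected) (a₀ : A)
    (k : ℕ) :
    k.factorial * (copiesInComponents H T a₀ (Fintype.card A + k)).card ≤
      (spanningMaps H T k).card := by
  have hmaps : ∀ f ∈ copiesInComponents H T a₀ (Fintype.card A + k),
      k.factorial ≤ ((spanningMaps H T k).filter fun ψ => ψ ∘ Sum.inl = f).card := by
    intro f hf
    simp only [copiesInComponents, Finset.mem_filter, Finset.mem_univ, true_and] at hf
    obtain ⟨⟨hinj, hhom⟩, hcard⟩ := hf
    set C := H.connectedComponentMk (f a₀) with hC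
    have hsub : Finset.univ.image f ⊆ C.supp.toFinset := by
      intro x hx
      obtain ⟨a, -, rfl⟩ := Finset.mem_image.1 hx
      rw [Set.mem_toFinset]
      exact mem_supp_of_hom hT hhom a₀ a
    set K := C.supp.toFinset \ Finset.univ.image f with hK
    have hKcard : K.card = k := by
      rw [hK, Finset.card_sdiff_of_subset hsub, hcard, Finset.card_image_of_injective _ hinj,
        Finset.card_univ]
      omega
    have hequiv : Fintype.card (Fin k ≃ K) = k.factorial := by
      rw [Fintype.card_equiv (Fintype.equivOfCardEq (by simp [hKcard])), Fintype.card_fin]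
    rw [← hequiv, ← Finset.card_univ]
    refine Finset.card_le_card_of_injOn (fun e => Sum.elim f fun i => (e i : V)) ?_ ?_
    · intro e _
      rw [Finset.mem_coe, Finset.mem_filter]
      refine ⟨?_, by ext; simp⟩
      simp only [spanningMaps, Finset.mem_filter, Finset.mem_univ, true_and]
      refine ⟨?_, ⟨C, ?_⟩, fun a b h => hhom a b h⟩
      · refine Function.Injective.sumElim hinj (Subtype.val_injective.comp e.injective) ?_
        intro a i h
        exact (Finset.mem_sdiff.1 (e i).2).2 (h ▸ Finset.mem_image_of_mem f (Finset.mem_univ a))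
      · rw [Set.Sum.elim_range]
        ext x
        constructor
        · rintro (⟨a, rfl⟩ | ⟨i, rfl⟩)
          · exact mem_supp_of_hom hT hhom a₀ a
          · exact Set.mem_toFinset.1 (Finset.mem_sdiff.1 (e i).2).1
        · intro hx
          by_cases hxf : x ∈ Finset.univ.image f
          · obtain ⟨a, -, rfl⟩ := Finset.mem_image.1 hxf
            exact Or.inl ⟨a, rfl⟩
          · have hxK : x ∈ K := Finset.mem_sdiff.2 ⟨Set.mem_toFinset.2 hx, hxf⟩
            exact Or.inr ⟨e.symm ⟨x, hxK⟩, by simp⟩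
    · intro e _ e' _ h
      ext i
      have := congrFun h (Sum.inr i)
      simpa using this
  have hcover : (copiesInComponents H T a₀ (Fintype.card A + k)).card * k.factorial ≤
      ∑ f ∈ copiesInComponents H T a₀ (Fintype.card A + k),
        ((spanningMaps H T k).filter fun ψ => ψ ∘ Sum.inl = f).card := by
    rw [← smul_eq_mul]
    exact Finset.card_nsmul_le_sum _ _ _ hmaps
  rw [mul_comm]
  refine hcover.trans ?_
  rw [← Finset.card_biUnion]
  · exact Finset.card_le_card (Finset.biUnion_subset.2 fun f _ => Finset.filter_subset _ _)
  · intro f _ f' _ hne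
    rw [Function.onFun, Finset.disjoint_left]
    intro ψ h h'
    exact hne ((Finset.mem_filter.1 h).2.symm.trans (Finset.mem_filter.1 h').2)

/-- With at least as many edges as vertices, `n^w q^e ≤ (n q)^w < 1`, too small to bound the number
of automorphisms. -/
lemma card_edgeSet_lt_of_copy (hH : IsSparse n q H) (hnq : (n : ℝ) * q < 1) [Nonempty W]
    {τ : SimpleGraph W} (c : τ.Copy H) : Nat.card τ.edgeSet + 1 ≤ Fintype.card W := by
  by_contra hlt
  have h1 := hH.card_aut_le c
  have h2 : (1 : ℝ) ≤ Nat.card (τ ≃g τ) := by exact_mod_cast card_aut_pos τ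
  have hq0 := q.2.1
  have h3 : (q : ℝ) ^ Nat.card τ.edgeSet ≤ (q : ℝ) ^ Fintype.card W :=
    pow_le_pow_of_le_one hq0 q.2.2 (by omega)
  have h4 : ((n : ℝ) * q) ^ Fintype.card W < 1 :=
    pow_lt_one₀ (by positivity) hnq Fintype.card_ne_zero
  rw [mul_pow] at h4
  have h5 : (n : ℝ) ^ Fintype.card W * (q : ℝ) ^ Nat.card τ.edgeSet ≤
      (n : ℝ) ^ Fintype.card W * (q : ℝ) ^ Fintype.card W := by gcongr
  linarith

lemma card_spanningMaps_le (hH : IsSparse n q H) (hnq : (n : ℝ) * q < 1) {T : SimpleGraph A}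
    (hT : T.Connected) (k : ℕ) :
    ((spanningMaps H T k).card : ℝ) ≤ ((Fintype.card A + k : ℕ) : ℝ) ^ k *
      (Real.exp 1 * ((n : ℝ) ^ (Fintype.card A + k) * (q : ℝ) ^ (Fintype.card A + k - 1))) := by
  have : Nonempty A := hT.nonempty
  have hq0 := q.2.1
  have hW : Fintype.card (A ⊕ Fin k) = Fintype.card A + k := by simp
  set 𝒯 := Finset.univ.filter fun τ : SimpleGraph (A ⊕ Fin k) => τ.Connected ∧
      Nat.card τ.edgeSet + 1 ≤ Fintype.card A + k ∧
      ∀ a b, T.Adj a b → τ.Adj (Sum.inl a) (Sum.inl b) with h𝒯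
  have hmaps : ∀ ψ ∈ spanningMaps H T k, ψ ∈ componentMaps H (H.comap ψ) ∧ H.comap ψ ∈ 𝒯 := by
    intro ψ hψ
    simp only [spanningMaps, Finset.mem_filter, Finset.mem_univ, true_and] at hψ
    have h1 : ψ ∈ componentMaps H (H.comap ψ) := mem_componentMaps.2 ⟨hψ.1, hψ.2.1, rfl⟩
    refine ⟨h1, Finset.mem_filter.2 ⟨Finset.mem_univ _, connected_of_mem_componentMaps h1, ?_,
      fun a b h => hψ.2.2 a b h⟩⟩
    rw [← hW]
    exact card_edgeSet_lt_of_copy hH hnq (SimpleGraph.Embedding.comap ⟨ψ, hψ.1⟩ H).toCopy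
  rw [Finset.card_eq_sum_card_fiberwise (f := fun ψ => H.comap ψ) fun ψ hψ => (hmaps ψ hψ).2]
  push_cast
  calc _ ≤ ∑ τ ∈ 𝒯,
        (Real.exp 1 * ((n : ℝ) ^ (Fintype.card A + k) * (q : ℝ) ^ (Fintype.card A + k - 1))) := by
        refine Finset.sum_le_sum fun τ hτ => ?_
        have hconn := (Finset.mem_filter.1 hτ).2.1
        have h1 := hconn.card_vert_le_card_edgeSet_add_one
        rw [Nat.card_eq_fintype_card, hW] at h1
        refine le_trans (Nat.cast_le.2 (Finset.card_le_card ?_))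
          ((card_componentMaps_le hH τ).trans ?_)
        · intro ψ hψ'
          obtain ⟨hψ, rfl⟩ := Finset.mem_filter.1 hψ'
          exact (hmaps ψ hψ).1
        · rw [hW]
          gcongr ?_ * (?_ * ?_)
          exact pow_le_pow_of_le_one hq0 q.2.2 (by omega)
    _ ≤ _ := by
        rw [Finset.sum_const, nsmul_eq_mul]
        gcongr
        exact_mod_cast card_trees_le T hT k

/-- The factor `(a + k)^k` for the number of trees is divided by `k!` and becomes at most `e^(a +
k)`, so each additional vertex of the component costs only `e n q`. -/
lemma card_copiesInComponents_le (hH : IsSparse n q H) (hnq : (n : ℝ) * q < 1)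
    {T : SimpleGraph A} (hT : T.Connected) (a₀ : A) (k : ℕ) :
    ((copiesInComponents H T a₀ (Fintype.card A + k)).card : ℝ) ≤
      Real.exp 1 ^ (Fintype.card A + 1) *
        ((n : ℝ) ^ Fintype.card A * (q : ℝ) ^ (Fintype.card A - 1)) *
        (Real.exp 1 * (n * q)) ^ k := by
  have hfac : (0 : ℝ) < k.factorial := by exact_mod_cast k.factorial_pos
  have hA : 0 < Fintype.card A := Fintype.card_pos_iff.2 hT.nonempty
  have hq0 := q.2.1
  have h1 := factorial_mul_card_copiesInComponents_le (H := H) hT a₀ k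
  have h2 := card_spanningMaps_le hH hnq hT k
  have h3 : (k.factorial : ℝ) * (copiesInComponents H T a₀ (Fintype.card A + k)).card ≤ _ :=
    le_trans (by exact_mod_cast h1) h2
  have h4 : ((Fintype.card A + k : ℕ) : ℝ) ^ k ≤
      k.factorial * Real.exp 1 ^ (Fintype.card A + k) := by
    have := Real.pow_div_factorial_le_exp ((Fintype.card A + k : ℕ) : ℝ) (Nat.cast_nonneg _) k
    rw [div_le_iff₀ hfac] at this
    rw [← Real.exp_nat_mul, mul_one, mul_comm]
    exact this
  refine le_of_mul_le_mul_left (h3.trans ?_) hfac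
  calc _ ≤ k.factorial * Real.exp 1 ^ (Fintype.card A + k) *
        (Real.exp 1 * ((n : ℝ) ^ (Fintype.card A + k) *
          (q : ℝ) ^ (Fintype.card A + k - 1))) := by gcongr
    _ = _ := by
        rw [show Fintype.card A + k - 1 = (Fintype.card A - 1) + k by omega, mul_pow, mul_pow,
          pow_add, pow_add, pow_add, pow_add]
        ring

lemma sum_pow_le_of_le {N : ℕ} {x : ℝ} (hx0 : 0 ≤ x) (hx : x ≤ 10 / 11) :
    ∑ k ∈ Finset.range N, x ^ k ≤ 11 := by
  have h := mul_neg_geom_sum x N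
  have h1 : 0 ≤ x ^ N := by positivity
  have h2 : 0 ≤ ∑ k ∈ Finset.range N, x ^ k := Finset.sum_nonneg fun _ _ => by positivity
  nlinarith

lemma labelledCopyCount_connected_le (hH : IsSparse n q H) (hnq : (n : ℝ) * q < 1 / 3)
    {T : SimpleGraph A} (hT : T.Connected) :
    (H.labelledCopyCount T : ℝ) ≤ 11 * Real.exp 1 ^ (Fintype.card A + 1) *
      ((n : ℝ) ^ Fintype.card A * (q : ℝ) ^ (Fintype.card A - 1)) := by
  rw [labelledCopyCount_eq_natCard, Nat.card_eq_fintype_card, Fintype.card_subtype]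
  obtain ⟨a₀⟩ := hT.nonempty
  have hq0 := q.2.1
  have hsub : (Finset.univ.filter fun f : A → V =>
      Function.Injective f ∧ ∀ a b, T.Adj a b → H.Adj (f a) (f b)) ⊆
      (Finset.range (Fintype.card V + 1)).biUnion fun k =>
        copiesInComponents H T a₀ (Fintype.card A + k) := by
    intro f hf
    obtain ⟨hinj, hhom⟩ := (Finset.mem_filter.1 hf).2
    set C := H.connectedComponentMk (f a₀) with hC
    have h1 : Fintype.card A ≤ C.supp.toFinset.card := by
      rw [← Finset.card_univ, ← Finset.card_image_of_injective _ hinj]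
      refine Finset.card_le_card fun x hx => ?_
      obtain ⟨a, -, rfl⟩ := Finset.mem_image.1 hx
      rw [Set.mem_toFinset]
      exact mem_supp_of_hom hT hhom a₀ a
    have h2 : C.supp.toFinset.card ≤ Fintype.card V := Finset.card_le_univ _
    refine Finset.mem_biUnion.2 ⟨C.supp.toFinset.card - Fintype.card A,
      Finset.mem_range.2 (by omega), ?_⟩
    exact Finset.mem_filter.2 ⟨Finset.mem_univ _, ⟨hinj, hhom⟩, by rw [← hC]; omega⟩
  -- This is where `n q < 1/3` is used: `e / 3 < 10/11`, so the geometric series over the component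
  -- sizes sums to at most 11.
  have he3 : Real.exp 1 * ((n : ℝ) * q) ≤ 10 / 11 := by
    have := Real.exp_one_lt_d9
    have h0 : 0 ≤ (n : ℝ) * q := by positivity
    nlinarith
  calc _ ≤ ((∑ k ∈ Finset.range (Fintype.card V + 1),
        (copiesInComponents H T a₀ (Fintype.card A + k)).card : ℕ) : ℝ) := Nat.cast_le.2
        ((Finset.card_le_card hsub).trans Finset.card_biUnion_le)
    _ ≤ ∑ k ∈ Finset.range (Fintype.card V + 1), Real.exp 1 ^ (Fintype.card A + 1) *
        ((n : ℝ) ^ Fintype.card A * (q : ℝ) ^ (Fintype.card A - 1)) *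
        (Real.exp 1 * (n * q)) ^ k := by
        push_cast
        exact Finset.sum_le_sum fun k _ =>
          card_copiesInComponents_le hH (by linarith) hT a₀ k
    _ ≤ Real.exp 1 ^ (Fintype.card A + 1) *
        ((n : ℝ) ^ Fintype.card A * (q : ℝ) ^ (Fintype.card A - 1)) * 11 := by
        rw [← Finset.mul_sum]
        gcongr
        exact sum_pow_le_of_le (by positivity) he3
    _ = _ := by ring

end Trees

/-! ### The subcritical bound for arbitrary graphs. -/

section SubcriticalBounds

open scoped Classical

variable {U V : Type*} [Fintype U] [Fintype V]
variable {F : SimpleGraph U} {H : SimpleGraph V} {S : Finset U} {n : ℕ} {p q : unitInterval}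

lemma IsUnsplit.connected_comap (hS : IsUnsplit F S) (hne : S.Nonempty) :
    (F.comap (Subtype.val : S → U)).Connected := by
  obtain ⟨u₀, hu₀⟩ := hne
  have : Nonempty S := ⟨⟨u₀, hu₀⟩⟩
  set T := F.comap (Subtype.val : S → U) with hT
  set A := S.filter fun u => ∃ h : u ∈ S, T.Reachable ⟨u₀, hu₀⟩ ⟨u, h⟩ with hA
  have hAS : A = S := by
    by_contra hne
    obtain ⟨a, ha, r, hr, har⟩ := hS A ((Finset.filter_subset _ _).ssubset_of_ne hne)
      ⟨u₀, Finset.mem_filter.2 ⟨hu₀, hu₀, SimpleGraph.Reachable.refl _⟩⟩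
    obtain ⟨haS, _, hreach⟩ := Finset.mem_filter.1 ha
    rw [Finset.mem_sdiff] at hr
    refine hr.2 (Finset.mem_filter.2 ⟨hr.1, hr.1, hreach.trans ?_⟩)
    exact SimpleGraph.Adj.reachable (show T.Adj ⟨a, haS⟩ ⟨r, hr.1⟩ from har)
  have hreach : ∀ u : S, T.Reachable ⟨u₀, hu₀⟩ u := by
    rintro ⟨u, hu⟩
    obtain ⟨_, _, h⟩ := Finset.mem_filter.1 (hAS ▸ hu : u ∈ A)
    exact h
  exact ⟨fun u v => (hreach u).symm.trans (hreach v)⟩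

lemma card_extensions_unsplit_le (hH : IsSparse n q H) (c : F.Copy H)
    (hnq : (n : ℝ) * q < 1 / 3) (hS : IsUnsplit F S) (hne : S.Nonempty)
    (hE : 1 ≤ (edgesIn F S).card) (φ : U → V) :
    ((extensions F H S S φ).card : ℝ) ≤
      (n : ℝ) ^ S.card * (11 * Real.exp 1 ^ 3 * q) ^ (edgesIn F S).card := by
  have hq0 := q.2.1
  have hcard : S.card = (edgesIn F S).card + 1 := by
    refine le_antisymm hS.card_le ?_
    by_contra hlt
    have h1 := hH.one_le_weight c S
    have h2 : (q : ℝ) ^ (edgesIn F S).card ≤ (q : ℝ) ^ S.card :=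
      pow_le_pow_of_le_one hq0 q.2.2 (by omega)
    have h3 : ((n : ℝ) * q) ^ S.card < 1 :=
      pow_lt_one₀ (by positivity) (by linarith) (Finset.card_pos.2 hne).ne'
    have h4 : weight n q F S ≤ ((n : ℝ) * q) ^ S.card := by
      rw [weight, mul_pow]
      gcongr
    linarith
  have h1 := labelledCopyCount_connected_le hH hnq (hS.connected_comap hne)
  rw [Fintype.card_coe] at h1
  have h2 : (extensions F H S S φ).card ≤
      H.labelledCopyCount (F.comap (Subtype.val : S → U)) := by
    rw [labelledCopyCount_eq_natCard, Nat.card_eq_fintype_card, Fintype.card_subtype]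
    refine Finset.card_le_card_of_injOn (fun f u => f u) ?_ ?_
    · intro f hf
      obtain ⟨-, hinj, hhom⟩ := mem_extensions.1 (Finset.mem_coe.1 hf)
      rw [Finset.mem_coe, Finset.mem_filter]
      exact ⟨Finset.mem_univ _, fun a b h => Subtype.ext (hinj a.2 b.2 h),
        fun a b h => hhom a a.2 b b.2 h⟩
    · intro f hf g hg h
      obtain ⟨hfφ, -⟩ := mem_extensions.1 (Finset.mem_coe.1 hf)
      obtain ⟨hgφ, -⟩ := mem_extensions.1 (Finset.mem_coe.1 hg)
      ext u
      by_cases hu : u ∈ S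
      · exact congrFun h ⟨u, hu⟩
      · rw [hfφ u hu, hgφ u hu]
  refine (Nat.cast_le.2 h2).trans (h1.trans ?_)
  set k := (edgesIn F S).card
  rw [hcard, Nat.add_sub_cancel, mul_pow]
  have he := Real.one_le_exp (show (0 : ℝ) ≤ 1 by norm_num)
  -- The presence of an edge, `k ≥ 1`, is needed: it gives `k + 2 ≤ 3k`.
  have h3 : 11 * Real.exp 1 ^ (k + 1 + 1) ≤ (11 * Real.exp 1 ^ 3) ^ k := by
    rw [mul_pow, ← pow_mul]
    gcongr
    · exact le_self_pow₀ (by norm_num) (by omega)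
    · omega
  calc _ ≤ (11 * Real.exp 1 ^ 3) ^ k * ((n : ℝ) ^ (k + 1) * (q : ℝ) ^ k) := by gcongr
    _ = _ := by ring

/-- Parts without edges between them are embedded one after the other, dropping the requirement that
their images be disjoint. Without isolated vertices, every part that cannot be split further has an
edge to absorb its constants. -/
lemma card_extensions_subcritical_le (hH : IsSparse n q H) (c : F.Copy H)
    (hnq : (n : ℝ) * q < 1 / 3) (S : Finset U) : (∀ u ∈ S, ∃ v ∈ S, F.Adj u v) → ∀ φ : U → V,
    ((extensions F H S S φ).card : ℝ) ≤
      (n : ℝ) ^ S.card * (11 * Real.exp 1 ^ 3 * q) ^ (edgesIn F S).card := by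
  have hq0 := q.2.1
  induction S using Finset.strongInduction with
  | H S ih =>
  intro hS φ
  rcases S.eq_empty_or_nonempty with rfl | ⟨u, hu⟩
  · have : edgesIn F ∅ = ∅ := by
      ext e
      induction e with | _ u v => simp [mk_mem_edgesIn]
    rw [this, Finset.card_empty, Finset.card_empty, pow_zero, pow_zero, mul_one]
    exact_mod_cast card_extensions_empty_le φ
  by_cases hsplit : IsUnsplit F S
  · obtain ⟨v, hv, huv⟩ := hS u hu
    exact card_extensions_unsplit_le hH c hnq hsplit ⟨u, hu⟩
      (Finset.card_pos.2 ⟨s(u, v), mk_mem_edgesIn.2 ⟨huv, hu, hv⟩⟩) φ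
  rw [IsUnsplit] at hsplit
  push Not at hsplit
  obtain ⟨A, hAS, hA, hno⟩ := hsplit
  have hA' : S \ A ⊂ S := Finset.sdiff_ssubset hAS.1 hA
  have hunion : A ∪ S \ A = S := Finset.union_sdiff_of_subset hAS.1
  have hAA : S \ (S \ A) = A := Finset.sdiff_sdiff_eq_self hAS.1
  have h1 := ih A hAS (fun a ha => by
    obtain ⟨v, hv, hav⟩ := hS a (hAS.1 ha)
    refine ⟨v, ?_, hav⟩
    by_contra hvA
    exact hno a ha v (Finset.mem_sdiff.2 ⟨hv, hvA⟩) hav)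
  have h2 := ih (S \ A) hA' (fun a ha => by
    obtain ⟨v, hv, hav⟩ := hS a (Finset.mem_sdiff.1 ha).1
    refine ⟨v, Finset.mem_sdiff.2 ⟨hv, fun hvA => ?_⟩, hav⟩
    exact hno v hvA a ha hav.symm)
  have hbd : outerBoundary F S (S \ A) = ∅ := by
    ext b
    simp only [Finset.notMem_empty, iff_false]
    intro hb
    obtain ⟨⟨hbS, hbA⟩, r, hr, hbr⟩ := mem_outerBoundary.1 hb
    have : b ∈ A := by
      by_contra h
      exact hbA (Finset.mem_sdiff.2 ⟨hbS, h⟩)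
    exact hno b this r hr hbr
  have hedges := card_edgesIn_eq F S (S \ A)
  rw [hAA, edgesTouching_eq_edgesIn Finset.sdiff_subset hbd] at hedges
  have hcard := Finset.card_sdiff_add_card_eq_card hAS.1
  have hchain := card_extensions_le_mul (F := F) (H := H) (S := S) (A := A) (A' := S \ A) φ
    (a := (n : ℝ) ^ A.card * (11 * Real.exp 1 ^ 3 * q) ^ (edgesIn F A).card)
    (b := (n : ℝ) ^ (S \ A).card * (11 * Real.exp 1 ^ 3 * q) ^ (edgesIn F (S \ A)).card)
    (by positivity) (by rw [hAA]; exact h1 φ) (fun ψ =>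
      (Nat.cast_le.2 (Finset.card_le_card (extensions_self_mono hA'.1 ψ))).trans (h2 ψ))
  rw [hunion] at hchain
  refine hchain.trans (le_of_eq ?_)
  rw [hedges, ← hcard, pow_add, pow_add]
  ring

/-- The constant may be taken to be `1 / (22 e⁵)`. -/
lemma copyCount_bounds_subcritical (hH : IsSparse n q H) (c : F.Copy H)
    (hqp : (q : ℝ) = 1 / (22 * Real.exp 1 ^ 5) * p) (hqn : (q : ℝ) < 1 / (3 * (n : ℝ))) :
    (H.copyCount F : ℝ) ≤ expectedCopies n p F ∧
      (F.edgeSet.Nonempty → (H.copyCount F : ℝ) < expectedCopies n p F) := by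
  have hq0 := q.2.1
  have hn : (0 : ℝ) < n := by
    rcases Nat.eq_zero_or_pos n with rfl | h
    · norm_num at hqn
      linarith
    · exact_mod_cast h
  have hnq : (n : ℝ) * q < 1 / 3 := by
    rw [lt_div_iff₀ (by positivity)] at hqn
    linarith
  -- With the factor `e^2` this gives `11 e^5 q`, half of `p`, hence a strict inequality.
  refine copyCount_bounds_of_extensions hH c (r := 11 * Real.exp 1 ^ 3 * q) (by positivity)
    (fun hE => ?_) (fun _ φ => ?_)
  · have hq := hH.pos_of_edge c hE
    have hp : (p : ℝ) = 22 * Real.exp 1 ^ 5 * q := by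
      rw [hqp]
      field_simp
    rw [hp]
    have : 0 < Real.exp 1 ^ 5 * (q : ℝ) := by positivity
    nlinarith
  · have := card_extensions_subcritical_le hH c hnq (nonisolated F) (fun u hu => by
      obtain ⟨v, hv⟩ := mem_nonisolated.1 hu
      exact ⟨v, mem_nonisolated.2 ⟨u, hv.symm⟩, hv⟩) φ
    rwa [edgesIn_nonisolated] at this

end SubcriticalBounds

theorem theorem1p8 :
    (∃ K : ℝ, 0 < K ∧
      ∀ (n : ℕ) (V : Type*) [Fintype V] (H : SimpleGraph V) (p q : unitInterval),
        IsSparse n q H →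
        (p : ℝ) = K * (q : ℝ) * (Real.logb 2 (n : ℝ)) ^ 2 →
        ∀ F : H.Subgraph,
          (H.copyCount F.coe : ℝ) ≤ expectedCopies n p F.coe ∧
          (F.edgeSet.Nonempty → (H.copyCount F.coe : ℝ) < expectedCopies n p F.coe)) ∧
    (∃ α : ℝ, 0 < α ∧
      ∀ (n : ℕ) (V : Type*) [Fintype V] (H : SimpleGraph V) (p q : unitInterval),
        IsSparse n q H →
        (q : ℝ) = α * (p : ℝ) →
        (q : ℝ) < 1 / (3 * (n : ℝ)) →
        ∀ F : H.Subgraph,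
          (H.copyCount F.coe : ℝ) ≤ expectedCopies n p F.coe ∧
          (F.edgeSet.Nonempty → (H.copyCount F.coe : ℝ) < expectedCopies n p F.coe)) := by
  classical
  refine ⟨⟨128 * Real.exp 1 ^ 4, by positivity, ?_⟩, ⟨1 / (22 * Real.exp 1 ^ 5), by positivity, ?_⟩⟩
  · intro n V _ H p q hH hp F
    have h := copyCount_bounds_log_sq hH F.coeCopy hp
    refine ⟨h.1, fun hF => h.2 ?_⟩
    rw [← F.image_coe_edgeSet_coe] at hF
    exact hF.of_image
  · intro n V _ H p q hH hqp hqn F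
    have h := copyCount_bounds_subcritical hH F.coeCopy hqp hqn
    refine ⟨h.1, fun hF => h.2 ?_⟩
    rw [← F.image_coe_edgeSet_coe] at hF
    exact hF.of_image
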